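/- Let $n\ge 2$, $p\ge 1$ and $s\in\{1,\dots,p\}$ be integers, let $\gamma\in[0,1)$ and $\rho>0$, and put $\Sigma(\gamma)=(1-\gamma)I_p+\gamma\mathbf 1_p\mathbf 1_p^{T}$. We observe $X=(X_1,\dots,X_n)$ with independent columns $X_t\sim N_p(\theta_t,\Sigma(\gamma))$, and write $\mathbb E_\theta$ for the corresponding expectation. Let $\Theta_0(p,n)$ be the set of $\theta=(\theta_1,\dots,\theta_n)\in\mathbb R^{p\times n}$ with $\theta_1=\dots=\theta_n$, and let $\Theta(p,n,s,\rho)$ be the set of $\theta$ for which there are $t_0\in\{1,\dots,n-1\}$ and $\mu_1,\mu_2\in\mathbb R^p$ such that $\theta_t=\mu_1$ for $t\le t_0$, $\theta_t=\mu_2$ for $t>t_0$, $\mu_1-\mu_2$ has at most $s$ nonzero coordinates, and $\frac{t_0(n-t_0)}{n}\|\mu_1-\mu_2\|^2\ge\rho^2$. For $t\in\mathcal T:=\{1,2,4,\dots,2^{\lfloor\log_2(n/2)\rfloor}\}$ let $$Y_t=\frac{(X_1+\dots+X_t)-(X_{n-t+1}+\dots+X_n)}{\sqrt{2t}},\qquad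 \widetilde Y_t=\frac{Y_t-\mathrm{Median}(Y_t)\mathbf 1_p}{\sqrt{1-\gamma}},$$ where $\mathrm{Median}(v)$ is the average of the two middle order statistics of the coordinates of $v$ (the middle one if $p$ is odd). For $a\ge 0$ let $\nu_a=\mathbb E(Z^2\mid |Z|\ge a)$ with $Z\sim N(0,1)$, $f_a(x)=(x^2-\nu_a)\mathbf 1_{\{|x|\ge a\}}$, and, for $C'\ge0$, $$g_{a,C'}(x)=\inf\Bigl\{f_a(y):|y-x|\le C'\sqrt{\tfrac{\log\log(8n)}{p}}\Bigr\},\qquad \psi_{a,r,C'}=\mathbf 1_{\{\max_{t\in\mathcal T}\sum_{j=1}^p g_{a,C'}(\widetilde Y_t(j))>r\}}.$$ Then there exist universal constants $c,C'>0$ such that for every $\epsilon\in(0,1)$ there are $C>0$ and $n_0\in\mathbb N$, both depending only on $\epsilon$, with the following property. Whenever $n\ge \max(n_0,2)$, $\gamma\in[0,1)$, $1\le s\le p$, $s\le (p\log\log(8n))^{1/5}$ and $\frac{\log\log(8n)}{p}\le c$, the test $\psi_{a,r,C'}$ with $a\ge 0$, $$a^2=4\log\Bigl(\frac{ep\log\log(8n)}{s^2}\Bigr),\qquad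 r=C\Bigl\{s\log\Bigl(\frac{ep\log\log(8n)}{s^2}\Bigr)\vee\log\log(8n)\Bigr\},$$ is a measurable function of $X$ and satisfies $$\sup_{\theta\in\Theta_0(p,n)}\mathbb E_\theta\,\psi_{a,r,C'}+\sup_{\theta\in\Theta(p,n,s,\rho)}\mathbb E_\theta(1-\psi_{a,r,C'})\le\epsilon$$ for every $\rho>0$ with $$\rho^2\ge 32C(1-\gamma)\Bigl\{s\log\Bigl(\frac{ep\log\log(8n)}{s^2}\Bigr)\vee\log\log(8n)\Bigr\}.$$ -/

import Mathlib

open MeasureTheory ProbabilityTheory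

noncomputable section

namespace SparseChange

/-- A `p × n` matrix, stored as the family of its `n` columns in Euclidean `p`-space.
Column number `t` (with `1 ≤ t ≤ n`) is the value at the index `t - 1 : Fin n`. -/
abbrev Data (p n : ℕ) : Type := Fin n → EuclideanSpace ℝ (Fin p)

/-- The iterated logarithm `log log (8 n)`. -/
def loglog (n : ℕ) : ℝ := Real.log (Real.log (8 * (n : ℝ)))

/-- `log (e p log log (8 n) / s ^ 2)`. -/
def logTerm (p n s : ℕ) : ℝ :=
  Real.log (Real.exp 1 * (p : ℝ) * loglog n / (s : ℝ) ^ 2)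

/-- `s log (e p log log (8 n) / s ^ 2) ∨ log log (8 n)`. -/
def sparseRate (p n s : ℕ) : ℝ := max ((s : ℝ) * logTerm p n s) (loglog n)

/-- The equicorrelation matrix `(1 - γ) I + γ 1 1ᵀ`. -/
def equicorr (p : ℕ) (γ : ℝ) : Matrix (Fin p) (Fin p) ℝ :=
  (1 - γ) • (1 : Matrix (Fin p) (Fin p) ℝ) + γ • Matrix.of (fun _ _ => (1 : ℝ))

/-- The law of the data: independent columns, the `t`-th one distributed as `N_p (θ_t, S)`. -/
def law {p n : ℕ} (S : Matrix (Fin p) (Fin p) ℝ) (θ : Data p n) : Measure (Data p n) :=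
  Measure.pi (fun i => multivariateGaussian (θ i) S)

/-- Mean matrices without a changepoint. -/
def nullSpace (p n : ℕ) : Set (Data p n) :=
  {θ | ∃ μ : EuclideanSpace ℝ (Fin p), ∀ i, θ i = μ}

/-- Mean matrices with a changepoint at time `t₀`: the columns `1, …, t₀` equal `μ₁`, the columns
`t₀ + 1, …, n` equal `μ₂`, the difference has at most `s` nonzero entries, and
`t₀ (n - t₀) / n * ‖μ₁ - μ₂‖ ^ 2 ≥ ρ ^ 2`. -/
def altSpaceAt (p n s : ℕ) (ρ : ℝ) (t₀ : ℕ) : Set (Data p n) :=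
  {θ | ∃ μ₁ μ₂ : EuclideanSpace ℝ (Fin p),
    (∀ i : Fin n, (i : ℕ) < t₀ → θ i = μ₁) ∧
    (∀ i : Fin n, t₀ ≤ (i : ℕ) → θ i = μ₂) ∧
    (Finset.univ.filter (fun j : Fin p => (μ₁ - μ₂) j ≠ 0)).card ≤ s ∧
    ρ ^ 2 ≤ (t₀ : ℝ) * ((n : ℝ) - (t₀ : ℝ)) / (n : ℝ) * ‖μ₁ - μ₂‖ ^ 2}

/-- Mean matrices with a sparse changepoint at some time `t₀ ∈ {1, …, n - 1}`. -/
def altSpace (p n s : ℕ) (ρ : ℝ) : Set (Data p n) :=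
  ⋃ t₀ ∈ Finset.Icc 1 (n - 1), altSpaceAt p n s ρ t₀

/-- The dyadic grid `{1, 2, 4, …, 2 ^ ⌊log₂ (n / 2)⌋}` (`Nat.log 2 m = ⌊log₂ m⌋` for `m ≥ 1`). -/
def grid (n : ℕ) : Finset ℕ :=
  (Finset.range (Nat.log 2 (n / 2) + 1)).image (fun k => 2 ^ k)

theorem grid_nonempty (n : ℕ) : (grid n).Nonempty := by
  simp [grid]

/-- The CUSUM vector
`Y_t = ((X_1 + … + X_t) - (X_{n-t+1} + … + X_n)) / √(2 t)`. -/
def cusum {p n : ℕ} (X : Data p n) (t : ℕ) : EuclideanSpace ℝ (Fin p) :=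
  (Real.sqrt (2 * (t : ℝ)))⁻¹ •
    ((∑ i ∈ Finset.univ.filter (fun i : Fin n => (i : ℕ) < t), X i) -
      (∑ i ∈ Finset.univ.filter (fun i : Fin n => n - t ≤ (i : ℕ)), X i))

/-- The sample median of `v_1, …, v_p`: the average of the two middle order statistics
(which coincide for odd `p`); it is only used for `p ≥ 1`. -/
def median {p : ℕ} (v : Fin p → ℝ) : ℝ :=
  if h : 0 < p then
    (v (Tuple.sort v ⟨(p - 1) / 2, by omega⟩) + v (Tuple.sort v ⟨p / 2, by omega⟩)) / 2
  else 0

/-- The `j`-th coordinate of the median-centred CUSUM vector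
`(Y_t - Median(Y_t) 1_p) / √(1 - γ)`. -/
def centredCusum {p n : ℕ} (γ : ℝ) (X : Data p n) (t : ℕ) (j : Fin p) : ℝ :=
  (cusum X t j - median (fun k => cusum X t k)) / Real.sqrt (1 - γ)

/-- `ν_a = E (Z ^ 2 | |Z| ≥ a)` for a standard normal `Z`. -/
def nu (a : ℝ) : ℝ :=
  ∫ z, z ^ 2 ∂(ProbabilityTheory.cond (gaussianReal 0 1) {z : ℝ | a ≤ |z|})

/-- `f_a (x) = (x ^ 2 - ν_a) 1{|x| ≥ a}`. -/
def thresh (a x : ℝ) : ℝ := if a ≤ |x| then x ^ 2 - nu a else 0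

/-- `g_{a, δ} (x) = inf {f_a (y) : |y - x| ≤ δ}`. -/
def robustThresh (a δ x : ℝ) : ℝ := sInf (thresh a '' {y : ℝ | |y - x| ≤ δ})

/-- The statistic `max_{t ∈ grid} ∑_j g_a (Ỹ_t (j))`, where the infimum in `g_a` is over
the radius `C' √(log log (8 n) / p)`. -/
def statistic {p n : ℕ} (γ a C' : ℝ) (X : Data p n) : ℝ :=
  (grid n).sup' (grid_nonempty n) (fun t =>
    ∑ j : Fin p, robustThresh a (C' * Real.sqrt (loglog n / (p : ℝ))) (centredCusum γ X t j))

open scoped Classical in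
/-- The test that rejects (takes the value `1`) when the statistic exceeds `r`. -/
def test {p n : ℕ} (γ a r C' : ℝ) (X : Data p n) : ℝ :=
  if r < statistic γ a C' X then 1 else 0

/-- The worst-case total error
`sup_{θ ∈ Θ₀} E_θ ψ + sup_{θ ∈ Θ₁} E_θ (1 - ψ)` of a `[0, 1]`-valued test `ψ`. -/
def totalError {p n : ℕ} (S : Matrix (Fin p) (Fin p) ℝ) (Θ₀ Θ₁ : Set (Data p n))
    (ψ : Data p n → ℝ) : ENNReal :=
  (⨆ θ ∈ Θ₀, ∫⁻ X, ENNReal.ofReal (ψ X) ∂(law S θ)) +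
    (⨆ θ ∈ Θ₁, ∫⁻ X, ENNReal.ofReal (1 - ψ X) ∂(law S θ))

end SparseChange

end

noncomputable section

namespace SparseChange

/-! ### The sample median -/

/-! For `t` in the grid the two averaged blocks are disjoint, so `Y_t` is normal with covariance
`Σ(γ)`, that is, mean plus `√γ W 1 + √(1-γ) Z` with `W`, `Z` independent standard normals. The
median commutes with increasing affine maps, so centring removes `W` and the test sees `v + z -
median (v + z)`, where `z` is standard Gaussian and `v`, the rescaled mean, is `s`-sparse
(`law_centredCusum_mem`).

Write `L = log log (8n)`, `A` for `logTerm`, `R` for `sparseRate`. The median lies within `η = 20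
√(L/p)` of `0` outside probability `2 exp(-2L)` (`gaussPi_median_tail`, by Hoeffding). The infimum
over radius `η` in `g` then makes the unknown centring harmless.

Without a change, `g (z_j - median) ≤ f_a (z_j) ≤ z_j² 1{|z_j| ≥ a}`. Dropping `ν_a` costs nothing
because the sparsity assumption gives `p exp(-3A/2) ≤ s` (`mul_exp_logTerm_le`); a Chernoff bound
yields `exp(-2L) = (log 8n)⁻²`, and the union bound over at most `2 log (8n)` grid points costs `6 /
log (8n)`.

With a change, the grid point just below `min (t₀, n - t₀)` satisfies `‖v‖² ≥ 8 C R`. Coordinates in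
the support contribute about `v_j²/2` minus noise; the others are negative only when `|z_j| ≥ a -
2η`, and then by at most `max (ν_a, a²)`, which is of order `A`. By Markov there are only `O(s/ε)`
such losses, so the statistic exceeds `r = C R` for large `C` (`gaussPi_alternative_tail`). -/

theorem comp_sort_of_monotone {p : ℕ} {f : ℝ → ℝ} (hf : Monotone f) (v : Fin p → ℝ) (k : Fin p) :
    (f ∘ v) (Tuple.sort (f ∘ v) k) = f (v (Tuple.sort v k)) := by
  have h : (f ∘ v) ∘ Tuple.sort v = (f ∘ v) ∘ Tuple.sort (f ∘ v) :=
    Tuple.comp_sort_eq_comp_iff_monotone.2 (hf.comp (Tuple.monotone_sort v))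
  exact (congrFun h k).symm

theorem median_affine {p : ℕ} (hp : 0 < p) {c : ℝ} (hc : 0 ≤ c) (b : ℝ) (v : Fin p → ℝ) :
    median (fun j => c * v j + b) = c * median v + b := by
  have hf : Monotone (fun x : ℝ => c * x + b) := fun x y h => by
    have := mul_le_mul_of_nonneg_left h hc
    simpa using this
  have key := comp_sort_of_monotone hf v
  simp only [median, hp, dite_true]
  have h1 := key ⟨(p - 1) / 2, by omega⟩
  have h2 := key ⟨p / 2, by omega⟩
  simp only [Function.comp_def] at h1 h2
  rw [h1, h2]
  ring

/-- Counting replaces sorting: both the measurability of the median and its tail bound reduce to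
sums of indicators. -/
theorem orderStat_le_iff {p : ℕ} (v : Fin p → ℝ) (k : Fin p) (x : ℝ) :
    v (Tuple.sort v k) ≤ x ↔ (k : ℕ) < (Finset.univ.filter fun j => v j ≤ x).card := by
  have h := Tuple.lt_card_le_iff_apply_le_of_monotone (f := v ∘ Tuple.sort v) (j := k) (a := x)
    (Tuple.monotone_sort v)
  rw [Function.comp_apply] at h
  rw [← h]
  have : (Finset.univ.filter fun j => v j ≤ x).card
      = (Finset.univ.filter fun j => (v ∘ Tuple.sort v) j ≤ x).card := by
    symm
    apply Finset.card_bij (fun j _ => Tuple.sort v j)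
    · intro j hj; simpa using hj
    · intro i _ j _ hij; exact (Tuple.sort v).injective hij
    · intro j hj
      exact ⟨(Tuple.sort v).symm j, by simpa using hj, by simp⟩
  rw [this]

theorem measurable_orderStat {p : ℕ} (k : Fin p) :
    Measurable (fun v : Fin p → ℝ => v (Tuple.sort v k)) := by
  refine measurable_of_Iic fun x => ?_
  have : (fun v : Fin p → ℝ => v (Tuple.sort v k)) ⁻¹' Set.Iic x
      = {v | ((k : ℕ) : ℝ) < ∑ j, (if v j ≤ x then (1 : ℝ) else 0)} := by
    ext v
    simp only [Set.mem_preimage, Set.mem_Iic, orderStat_le_iff, Set.mem_ofPred_eq,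
      Finset.sum_boole, Nat.cast_lt]
  rw [this]
  refine measurableSet_lt measurable_const (Finset.measurable_sum _ fun j _ => ?_)
  exact Measurable.ite (measurableSet_le (measurable_pi_apply j) measurable_const)
    measurable_const measurable_const

theorem measurable_median {p : ℕ} : Measurable (median : (Fin p → ℝ) → ℝ) := by
  unfold median
  by_cases hp : 0 < p
  · simp only [hp, dite_true]
    exact ((measurable_orderStat _).add (measurable_orderStat _)).div_const 2
  · simp only [hp, dite_false]
    exact measurable_const

theorem half_le_card_of_lt_median {p : ℕ} (hp : 0 < p) (v : Fin p → ℝ) {h : ℝ}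
    (hm : h < median v) : (p : ℝ) / 2 ≤ (Finset.univ.filter fun j => h < v j).card := by
  simp only [median, hp, dite_true] at hm
  have hle : v (Tuple.sort v ⟨(p - 1) / 2, by omega⟩) ≤ v (Tuple.sort v ⟨p / 2, by omega⟩) :=
    Tuple.monotone_sort v (by simp only [Fin.mk_le_mk]; omega)
  -- If the average of the two middle values exceeds `h`, so does the larger one, so at most `p / 2`
  -- coordinates are `≤ h`.
  have hlt : ¬ v (Tuple.sort v ⟨p / 2, by omega⟩) ≤ h := by
    intro hh; linarith
  rw [orderStat_le_iff] at hlt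
  have hc := Finset.card_filter_add_card_filter_not (s := (Finset.univ : Finset (Fin p)))
    (fun j => v j ≤ h)
  simp only [not_le, Finset.card_univ, Fintype.card_fin] at hc
  simp only [not_lt] at hlt
  have : p ≤ 2 * (Finset.univ.filter fun j => h < v j).card := by omega
  have : (p : ℝ) ≤ 2 * ((Finset.univ.filter fun j => h < v j).card : ℝ) := by exact_mod_cast this
  linarith

theorem half_le_card_of_median_lt {p : ℕ} (hp : 0 < p) (v : Fin p → ℝ) {h : ℝ}
    (hm : median v < h) : (p : ℝ) / 2 ≤ (Finset.univ.filter fun j => v j < h).card := by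
  simp only [median, hp, dite_true] at hm
  have hle : v (Tuple.sort v ⟨(p - 1) / 2, by omega⟩) ≤ v (Tuple.sort v ⟨p / 2, by omega⟩) :=
    Tuple.monotone_sort v (by simp only [Fin.mk_le_mk]; omega)
  have hlt : v (Tuple.sort v ⟨(p - 1) / 2, by omega⟩) < h := by linarith
  have h2 := (orderStat_le_iff v ⟨(p - 1) / 2, by omega⟩ _).1 le_rfl
  have h3 : (Finset.univ.filter fun j => v j ≤ v (Tuple.sort v ⟨(p - 1) / 2, by omega⟩)).card
      ≤ (Finset.univ.filter fun j => v j < h).card := by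
    apply Finset.card_le_card
    intro j hj
    simp only [Finset.mem_filter, Finset.mem_univ, true_and] at hj ⊢
    linarith
  simp only at h2
  have : p ≤ 2 * (Finset.univ.filter fun j => v j < h).card := by omega
  have : (p : ℝ) ≤ 2 * ((Finset.univ.filter fun j => v j < h).card : ℝ) := by exact_mod_cast this
  linarith

/-! ### The thresholding functions -/

theorem nu_nonneg (a : ℝ) : 0 ≤ nu a := integral_nonneg fun z => sq_nonneg z

theorem thresh_le (a x : ℝ) : thresh a x ≤ if a ≤ |x| then x ^ 2 else 0 := by
  unfold thresh
  have := nu_nonneg a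
  split_ifs <;> linarith

/-- One bound covers both branches: the loss is `ν_a` above the threshold and `x² < a²` below it. -/
theorem sq_sub_le_thresh (a x : ℝ) : x ^ 2 - max (nu a) (a ^ 2) ≤ thresh a x := by
  unfold thresh
  have h1 := le_max_left (nu a) (a ^ 2)
  have h2 := le_max_right (nu a) (a ^ 2)
  split_ifs with h
  · linarith
  · push Not at h
    have : |x| ^ 2 ≤ a ^ 2 := pow_le_pow_left₀ (abs_nonneg x) h.le 2
    rw [sq_abs] at this
    linarith

theorem neg_le_thresh (a x : ℝ) : -max (nu a) (a ^ 2) ≤ thresh a x := by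
  have := sq_sub_le_thresh a x
  nlinarith [sq_nonneg x]

theorem thresh_eq_zero {a x : ℝ} (h : |x| < a) : thresh a x = 0 := by
  simp [thresh, not_le.2 h]

theorem bddBelow_thresh_image (a δ x : ℝ) : BddBelow (thresh a '' {y : ℝ | |y - x| ≤ δ}) :=
  ⟨-max (nu a) (a ^ 2), by rintro _ ⟨y, -, rfl⟩; exact neg_le_thresh a y⟩

theorem robustThresh_le {a δ x y : ℝ} (h : |y - x| ≤ δ) : robustThresh a δ x ≤ thresh a y :=
  csInf_le (bddBelow_thresh_image a δ x) ⟨y, h, rfl⟩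

theorem thresh_image_nonempty {a δ : ℝ} (hδ : 0 ≤ δ) (x : ℝ) :
    (thresh a '' {y : ℝ | |y - x| ≤ δ}).Nonempty :=
  ⟨_, x, by simpa using hδ, rfl⟩

theorem le_robustThresh {a δ x b : ℝ} (hδ : 0 ≤ δ) (h : ∀ y, |y - x| ≤ δ → b ≤ thresh a y) :
    b ≤ robustThresh a δ x :=
  le_csInf (thresh_image_nonempty hδ x) (by rintro _ ⟨y, hy, rfl⟩; exact h y hy)

-- The thickening is a Minkowski sum of convex sets, hence an interval.
open Pointwise in
theorem measurableSet_thickening_of_convex {s : Set ℝ} (hs : Convex ℝ s) (δ : ℝ) :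
    MeasurableSet {x : ℝ | ∃ y ∈ s, |y - x| ≤ δ} := by
  have : {x : ℝ | ∃ y ∈ s, |y - x| ≤ δ} = s + Metric.closedBall (0 : ℝ) δ := by
    ext x
    simp only [Set.mem_ofPred_eq, Set.mem_add, mem_closedBall_zero_iff, Real.norm_eq_abs]
    constructor
    · rintro ⟨y, hy, h⟩
      exact ⟨y, hy, x - y, by rwa [abs_sub_comm], by ring⟩
    · rintro ⟨y, hy, z, hz, rfl⟩
      exact ⟨y, hy, by simpa using hz⟩
  rw [this]
  exact (hs.add (convex_closedBall 0 δ)).ordConnected.measurableSet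

/-- The infimum is uncountable, but `{g < q}` is the `δ`-thickening of `{f_a < q}`, which is a union
of three intervals: the middle one, where `f_a = 0`, and one on each side. -/
theorem measurable_robustThresh {a δ : ℝ} (hδ : 0 ≤ δ) :
    Measurable (robustThresh a δ) := by
  refine measurable_of_Iio fun q => ?_
  have hset : robustThresh a δ ⁻¹' Set.Iio q =
      {x | ∃ y ∈ {y : ℝ | |y| < a ∧ 0 < q}, |y - x| ≤ δ} ∪
      ({x | ∃ y ∈ {y : ℝ | a ≤ y ∧ |y| < Real.sqrt (q + nu a)}, |y - x| ≤ δ} ∪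
      {x | ∃ y ∈ {y : ℝ | y ≤ -a ∧ |y| < Real.sqrt (q + nu a)}, |y - x| ≤ δ}) := by
    ext x
    have hsq : ∀ y : ℝ, |y| < Real.sqrt (q + nu a) ↔ y ^ 2 - nu a < q := fun y => by
      rw [Real.lt_sqrt (abs_nonneg y), sq_abs]
      constructor <;> intro h <;> linarith
    simp only [Set.mem_preimage, Set.mem_Iio, Set.mem_union, Set.mem_ofPred_eq, hsq]
    unfold robustThresh
    rw [csInf_lt_iff (bddBelow_thresh_image a δ x) (thresh_image_nonempty hδ x)]
    constructor
    · rintro ⟨_, ⟨y, hy, rfl⟩, hlt⟩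
      by_cases h : a ≤ |y|
      · simp only [thresh, h, if_true] at hlt
        right
        rcases le_abs.1 h with h' | h'
        · exact Or.inl ⟨y, ⟨h', hlt⟩, hy⟩
        · exact Or.inr ⟨y, ⟨by linarith, hlt⟩, hy⟩
      · simp only [thresh, h, if_false] at hlt
        exact Or.inl ⟨y, ⟨not_le.1 h, hlt⟩, hy⟩
    · rintro (⟨y, ⟨h1, h2⟩, h3⟩ | ⟨y, ⟨h1, h2⟩, h3⟩ | ⟨y, ⟨h1, h2⟩, h3⟩)
      · exact ⟨_, ⟨y, h3, rfl⟩, by rwa [thresh_eq_zero h1]⟩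
      · exact ⟨_, ⟨y, h3, rfl⟩, by simpa [thresh, le_abs.2 (Or.inl h1)] using h2⟩
      · have : a ≤ |y| := le_abs.2 (Or.inr (by linarith))
        exact ⟨_, ⟨y, h3, rfl⟩, by simpa [thresh, this] using h2⟩
  rw [hset]
  have hconv : ∀ b : ℝ, Convex ℝ {y : ℝ | |y| < b} := fun b => by
    simpa [Metric.ball, Real.dist_eq] using convex_ball (0 : ℝ) b
  refine (measurableSet_thickening_of_convex ?_ δ).union
    ((measurableSet_thickening_of_convex ?_ δ).union (measurableSet_thickening_of_convex ?_ δ))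
  · by_cases hq : 0 < q
    · simpa [hq] using hconv a
    · simpa [hq] using convex_empty
  · exact (convex_Ici a).inter (hconv _)
  · exact (convex_Iic (-a)).inter (hconv _)

theorem measurable_cusum {p n : ℕ} (t : ℕ) :
    Measurable (fun X : Data p n => cusum X t) := by
  unfold cusum
  fun_prop

theorem measurable_centredCusum {p n : ℕ} (γ : ℝ) (t : ℕ) (j : Fin p) :
    Measurable (fun X : Data p n => centredCusum γ X t j) := by
  have h : ∀ k : Fin p, Measurable (fun X : Data p n => cusum X t k) := fun k =>
    (EuclideanSpace.proj (𝕜 := ℝ) k).continuous.measurable.comp (measurable_cusum t)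
  exact ((h j).sub (measurable_median.comp (measurable_pi_lambda _ h))).div_const _

theorem measurable_statistic {p n : ℕ} (γ : ℝ) {a C' : ℝ} (hC' : 0 ≤ C') :
    Measurable (statistic (p := p) (n := n) γ a C') := by
  have h := Finset.measurable_sup' (grid_nonempty n) (f := fun t (X : Data p n) =>
    ∑ j : Fin p, robustThresh a (C' * Real.sqrt (loglog n / (p : ℝ))) (centredCusum γ X t j))
    (fun t _ => Finset.measurable_sum _ fun j _ =>
      (measurable_robustThresh (by positivity)).comp (measurable_centredCusum γ t j))
  convert h using 1
  ext X
  simp [statistic]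

theorem measurable_test {p n : ℕ} (γ : ℝ) {a C' : ℝ} (r : ℝ) (hC' : 0 ≤ C') :
    Measurable (test (p := p) (n := n) γ a r C') := by
  unfold test
  exact Measurable.ite (measurableSet_lt measurable_const (measurable_statistic γ hC'))
    measurable_const measurable_const

/-! ### The law of the CUSUM vectors -/

theorem equicorr_posSemidef (p : ℕ) {γ : ℝ} (h0 : 0 ≤ γ) (h1 : γ ≤ 1) :
    (equicorr p γ).PosSemidef := by
  have h : (Matrix.of fun _ _ => (1 : ℝ) : Matrix (Fin p) (Fin p) ℝ)
      = Matrix.vecMulVec (fun _ => 1) (star fun _ => 1) := by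
    ext i j; simp [Matrix.vecMulVec]
  unfold equicorr
  rw [h]
  exact (Matrix.PosSemidef.one.smul (by linarith)).add
    ((Matrix.posSemidef_vecMulVec_self_star _).smul h0)

theorem dotProduct_equicorr_mulVec (p : ℕ) (γ : ℝ) (x : Fin p → ℝ) :
    x ⬝ᵥ (equicorr p γ).mulVec x = (1 - γ) * ∑ j, x j ^ 2 + γ * (∑ j, x j) ^ 2 := by
  have h : (Matrix.of fun _ _ => (1 : ℝ) : Matrix (Fin p) (Fin p) ℝ).mulVec x
      = fun _ => ∑ j, x j := by
    ext i; simp [Matrix.mulVec, dotProduct]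
  rw [equicorr, Matrix.add_mulVec, Matrix.smul_mulVec, Matrix.smul_mulVec, Matrix.one_mulVec, h,
    dotProduct_add, dotProduct_smul, dotProduct_smul]
  simp [dotProduct, ← Finset.sum_mul, pow_two]

instance isProbabilityMeasure_law {p n : ℕ} (S : Matrix (Fin p) (Fin p) ℝ) (θ : Data p n) :
    IsProbabilityMeasure (law S θ) := by
  unfold law; infer_instance

/-- The weight of the `i`-th column in the CUSUM vector at time `t`. -/
def cusumWeight (n t : ℕ) (i : Fin n) : ℝ :=
  (Real.sqrt (2 * (t : ℝ)))⁻¹ *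
    ((if (i : ℕ) < t then 1 else 0) - (if n - t ≤ (i : ℕ) then 1 else 0))

theorem cusum_eq_sum {p n : ℕ} (X : Data p n) (t : ℕ) :
    cusum X t = ∑ i, cusumWeight n t i • X i := by
  simp only [cusum, cusumWeight, mul_smul, ← Finset.smul_sum, sub_smul, Finset.sum_sub_distrib,
    ite_smul, one_smul, zero_smul, Finset.sum_filter]

theorem card_filter_lt {n t : ℕ} (h : t ≤ n) :
    (Finset.univ.filter fun i : Fin n => (i : ℕ) < t).card = t := by
  rw [Fin.card_filter_val_lt, min_eq_right h]

theorem card_filter_sub_le {n t : ℕ} (h : t ≤ n) :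
    (Finset.univ.filter fun i : Fin n => n - t ≤ (i : ℕ)).card = t := by
  have hc := Finset.card_filter_add_card_filter_not (s := (Finset.univ : Finset (Fin n)))
    (fun i => (i : ℕ) < n - t)
  simp only [not_lt, Finset.card_univ, Fintype.card_fin] at hc
  rw [card_filter_lt (Nat.sub_le n t)] at hc
  omega

/-- Since `2t ≤ n` the two blocks are disjoint, so `2t` weights equal `±1/√(2t)`. This is what
preserves the covariance in `map_cusum_law`. -/
theorem sum_cusumWeight_sq {n t : ℕ} (ht : 0 < t) (htn : 2 * t ≤ n) :
    ∑ i, cusumWeight n t i ^ 2 = 1 := by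
  have h : ∀ i : Fin n, cusumWeight n t i ^ 2 = (2 * (t : ℝ))⁻¹ *
      ((if (i : ℕ) < t then 1 else 0) + (if n - t ≤ (i : ℕ) then 1 else 0)) := by
    intro i
    rw [cusumWeight, mul_pow, inv_pow, Real.sq_sqrt (by positivity)]
    congr 1
    split_ifs with h1 h2
    · omega
    all_goals norm_num
  simp only [h, ← Finset.mul_sum, Finset.sum_add_distrib, Finset.sum_boole,
    card_filter_lt (by omega : t ≤ n), card_filter_sub_le (by omega : t ≤ n)]
  have : (t : ℝ) ≠ 0 := by positivity
  field_simp
  norm_num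

theorem map_cusum_law {p n t : ℕ} (ht : 0 < t) (htn : 2 * t ≤ n) {S : Matrix (Fin p) (Fin p) ℝ}
    (hS : S.PosSemidef) (θ : Data p n) :
    (law S θ).map (fun X => cusum X t) = multivariateGaussian (cusum θ t) S := by
  have : IsProbabilityMeasure ((law S θ).map (fun X => cusum X t)) :=
    Measure.isProbabilityMeasure_map (measurable_cusum t).aemeasurable
  apply Measure.ext_of_charFun
  ext u
  rw [charFun_multivariateGaussian hS, charFun_apply,
    integral_map (measurable_cusum t).aemeasurable (Measurable.aestronglyMeasurable (by fun_prop))]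
  have h1 : ∀ X : Data p n, Complex.exp (((inner ℝ (cusum X t) u : ℝ) : ℂ) * Complex.I)
      = ∏ i, Complex.exp (((inner ℝ (X i) (cusumWeight n t i • u) : ℝ) : ℂ) * Complex.I) := by
    intro X
    rw [cusum_eq_sum, sum_inner, Complex.ofReal_sum, Finset.sum_mul, Complex.exp_sum]
    simp only [real_inner_smul_left, real_inner_smul_right]
  simp only [h1]
  rw [law, integral_fintype_prod_eq_prod
    (f := fun i x => Complex.exp (((inner ℝ x (cusumWeight n t i • u) : ℝ) : ℂ) * Complex.I))]
  simp only [← charFun_apply, charFun_multivariateGaussian hS]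
  rw [← Complex.exp_sum, Finset.sum_sub_distrib, ← Finset.sum_mul, ← Complex.ofReal_sum]
  congr 2
  · rw [cusum_eq_sum, inner_sum]
    simp only [real_inner_smul_left, real_inner_smul_right]
  · have h2 : ∀ i : Fin n, (((cusumWeight n t i • u).ofLp ⬝ᵥ
        S.mulVec (cusumWeight n t i • u).ofLp : ℝ) : ℂ) / 2
        = ((cusumWeight n t i ^ 2 : ℝ) : ℂ) * (((u.ofLp ⬝ᵥ S.mulVec u.ofLp : ℝ) : ℂ) / 2) := by
      intro i
      rw [WithLp.ofLp_smul, Matrix.mulVec_smul, dotProduct_smul, smul_dotProduct]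
      simp only [smul_eq_mul]
      push_cast
      ring
    simp only [h2]
    rw [← Finset.sum_mul, ← Complex.ofReal_sum, sum_cusumWeight_sq ht htn]
    simp

/-- The law of `p` independent standard normal variables. -/
def gaussPi (p : ℕ) : Measure (Fin p → ℝ) := Measure.pi fun _ => gaussianReal 0 1

instance isProbabilityMeasure_gaussPi (p : ℕ) : IsProbabilityMeasure (gaussPi p) := by
  unfold gaussPi; infer_instance

theorem multivariateGaussian_equicorr {p : ℕ} {γ : ℝ} (h0 : 0 ≤ γ) (h1 : γ ≤ 1)
    (m : EuclideanSpace ℝ (Fin p)) :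
    multivariateGaussian m (equicorr p γ) =
      ((gaussianReal 0 1).prod (gaussPi p)).map (fun wz => WithLp.toLp 2
        (fun j => m j + (Real.sqrt γ * wz.1 + Real.sqrt (1 - γ) * wz.2 j))) := by
  have hmeas : Measurable (fun wz : ℝ × (Fin p → ℝ) => (WithLp.toLp 2
        (fun j => m j + (Real.sqrt γ * wz.1 + Real.sqrt (1 - γ) * wz.2 j)) :
        EuclideanSpace ℝ (Fin p))) := by fun_prop
  have := Measure.isProbabilityMeasure_map (μ := (gaussianReal 0 1).prod (gaussPi p))
    hmeas.aemeasurable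
  apply Measure.ext_of_charFun
  ext u
  rw [charFun_multivariateGaussian (equicorr_posSemidef p h0 h1), charFun_apply,
    integral_map hmeas.aemeasurable (Measurable.aestronglyMeasurable (by fun_prop))]
  have hexp : ∀ wz : ℝ × (Fin p → ℝ), Complex.exp (((inner ℝ (WithLp.toLp 2
        (fun j => m j + (Real.sqrt γ * wz.1 + Real.sqrt (1 - γ) * wz.2 j)) :
        EuclideanSpace ℝ (Fin p)) u : ℝ) : ℂ) * Complex.I)
      = Complex.exp (((inner ℝ u m : ℝ) : ℂ) * Complex.I) *
        (Complex.exp (((Real.sqrt γ * ∑ j, u j : ℝ) : ℂ) * (wz.1 : ℂ) * Complex.I) *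
        ∏ j, Complex.exp (((Real.sqrt (1 - γ) * u j : ℝ) : ℂ) * (wz.2 j : ℂ) * Complex.I)) := by
    intro wz
    rw [← Complex.exp_sum, ← Complex.exp_add, ← Complex.exp_add, PiLp.inner_apply,
      PiLp.inner_apply]
    congr 1
    simp only [RCLike.inner_apply, conj_trivial]
    push_cast
    simp only [Finset.mul_sum, Finset.sum_mul, ← Finset.sum_add_distrib]
    exact Finset.sum_congr rfl fun j _ => by ring
  simp only [hexp]
  rw [integral_const_mul, integral_prod_mul
    (f := fun w : ℝ => Complex.exp (((Real.sqrt γ * ∑ j, u j : ℝ) : ℂ) * (w : ℂ) * Complex.I))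
    (g := fun z : Fin p → ℝ =>
      ∏ j, Complex.exp (((Real.sqrt (1 - γ) * u j : ℝ) : ℂ) * (z j : ℂ) * Complex.I)),
    gaussPi, integral_fintype_prod_eq_prod (f := fun j (z : ℝ) =>
      Complex.exp (((Real.sqrt (1 - γ) * u j : ℝ) : ℂ) * (z : ℂ) * Complex.I))]
  simp only [← charFun_apply_real, charFun_gaussianReal]
  rw [← Complex.exp_sum, ← Complex.exp_add, ← Complex.exp_add, dotProduct_equicorr_mulVec]
  congr 1
  have e1 : ((Real.sqrt γ : ℝ) : ℂ) ^ 2 = (γ : ℂ) := by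
    rw [← Complex.ofReal_pow, Real.sq_sqrt h0]
  have e2 : ((Real.sqrt (1 - γ) : ℝ) : ℂ) ^ 2 = 1 - (γ : ℂ) := by
    rw [← Complex.ofReal_pow, Real.sq_sqrt (by linarith)]; push_cast; ring
  simp only [Complex.ofReal_zero, mul_zero, zero_mul, NNReal.coe_one, Complex.ofReal_one, one_mul,
    zero_sub, Complex.ofReal_mul, mul_pow, e1, e2, Finset.sum_neg_distrib, ← Finset.sum_div,
    ← Finset.mul_sum, Complex.ofReal_add, Complex.ofReal_sub, Complex.ofReal_sum,
    Complex.ofReal_pow]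
  ring

theorem median_cusum_shift {p : ℕ} (hp : 0 < p) {γ : ℝ} (h1 : γ < 1) (m z : Fin p → ℝ) (b : ℝ)
    (j : Fin p) :
    ((m j + (b + Real.sqrt (1 - γ) * z j)) -
        median (fun k => m k + (b + Real.sqrt (1 - γ) * z k))) / Real.sqrt (1 - γ) =
      (m j / Real.sqrt (1 - γ) + z j) - median (fun k => m k / Real.sqrt (1 - γ) + z k) := by
  have hs : 0 < Real.sqrt (1 - γ) := Real.sqrt_pos.2 (by linarith)
  have h : (fun k => m k + (b + Real.sqrt (1 - γ) * z k))
      = fun k => Real.sqrt (1 - γ) * (m k / Real.sqrt (1 - γ) + z k) + b := by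
    ext k; field_simp; ring
  rw [h, median_affine hp hs.le b (fun k => m k / Real.sqrt (1 - γ) + z k)]
  field_simp
  ring

/-- Up to a change of the mean, the median-centred CUSUM vector is a median-centred vector of
independent normal variables. -/
theorem law_centredCusum_mem {p n t : ℕ} (hp : 0 < p) (ht : 0 < t) (htn : 2 * t ≤ n) {γ : ℝ}
    (h0 : 0 ≤ γ) (h1 : γ < 1) (θ : Data p n) {B : Set (Fin p → ℝ)} (hB : MeasurableSet B) :
    law (equicorr p γ) θ {X | (fun j => centredCusum γ X t j) ∈ B} =
      gaussPi p {z | (fun j => (cusum θ t j / Real.sqrt (1 - γ) + z j) -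
        median (fun k => cusum θ t k / Real.sqrt (1 - γ) + z k)) ∈ B} := by
  have hG : Measurable (fun y : EuclideanSpace ℝ (Fin p) =>
      fun j => (y j - median (fun k => y k)) / Real.sqrt (1 - γ)) := by
    have h : Measurable (fun y : EuclideanSpace ℝ (Fin p) => fun k => y k) := by fun_prop
    exact measurable_pi_lambda _ fun j =>
      (((measurable_pi_apply j).comp h).sub (measurable_median.comp h)).div_const _
  have hGB := hG hB
  have e : {X : Data p n | (fun j => centredCusum γ X t j) ∈ B} =
      (fun X => cusum X t) ⁻¹' ((fun y : EuclideanSpace ℝ (Fin p) =>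
      fun j => (y j - median (fun k => y k)) / Real.sqrt (1 - γ)) ⁻¹' B) := rfl
  rw [e, ← Measure.map_apply (measurable_cusum t) hGB,
    map_cusum_law ht htn (equicorr_posSemidef p h0 h1.le),
    multivariateGaussian_equicorr h0 h1.le, Measure.map_apply (by fun_prop) hGB]
  -- The common factor `w` cancels against the median, so the preimage is a cylinder and `w`
  -- integrates out.
  have e2 : (fun wz : ℝ × (Fin p → ℝ) => (WithLp.toLp 2
        (fun j => cusum θ t j + (Real.sqrt γ * wz.1 + Real.sqrt (1 - γ) * wz.2 j)) :
        EuclideanSpace ℝ (Fin p))) ⁻¹' ((fun y : EuclideanSpace ℝ (Fin p) =>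
      fun j => (y j - median (fun k => y k)) / Real.sqrt (1 - γ)) ⁻¹' B) =
      Set.univ ×ˢ {z | (fun j => (cusum θ t j / Real.sqrt (1 - γ) + z j) -
        median (fun k => cusum θ t k / Real.sqrt (1 - γ) + z k)) ∈ B} := by
    ext ⟨w, z⟩
    simp only [Set.mem_preimage, Set.mem_prod, Set.mem_univ, true_and, Set.mem_ofPred_eq]
    simp only [median_cusum_shift hp h1 (fun k => cusum θ t k)]
  rw [e2, Measure.prod_prod, measure_univ, one_mul]

/-! ### One-dimensional normal estimates -/

theorem integral_exp_sq_gaussian :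
    ∫ x, Real.exp (15 / 32 * x ^ 2) ∂(gaussianReal 0 1) = 4 := by
  rw [integral_gaussianReal_eq_integral_smul one_ne_zero]
  have h : ∀ x : ℝ, gaussianPDFReal 0 1 x • Real.exp (15 / 32 * x ^ 2)
      = (Real.sqrt (2 * Real.pi))⁻¹ * Real.exp (-(1 / 32) * x ^ 2) := by
    intro x
    rw [gaussianPDFReal_def, smul_eq_mul, NNReal.coe_one, mul_one, mul_one, mul_assoc,
      ← Real.exp_add]
    congr 2
    ring
  simp only [h]
  rw [integral_const_mul, integral_gaussian,
    show Real.pi / (1 / 32) = 4 ^ 2 * (2 * Real.pi) by ring, Real.sqrt_mul (by norm_num) (2 * Real.pi),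
    Real.sqrt_sq (by norm_num)]
  have : Real.sqrt (2 * Real.pi) ≠ 0 := (Real.sqrt_pos.2 (by positivity)).ne'
  field_simp

theorem integrable_exp_sq_gaussian :
    Integrable (fun x : ℝ => Real.exp (15 / 32 * x ^ 2)) (gaussianReal 0 1) :=
  -- A non-integrable function would have Bochner integral `0`.
  Integrable.of_integral_ne_zero (by rw [integral_exp_sq_gaussian]; norm_num)

theorem measurableSet_le_abs (b : ℝ) : MeasurableSet {x : ℝ | b ≤ |x|} :=
  measurableSet_le measurable_const (by fun_prop)

theorem gaussian_abs_tail {b : ℝ} (hb : 0 ≤ b) :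
    (gaussianReal 0 1).real {x | b ≤ |x|} ≤ 4 * Real.exp (-(15 / 32) * b ^ 2) := by
  have h := mul_meas_ge_le_integral_of_nonneg (μ := gaussianReal 0 1)
    (ae_of_all _ fun x => (Real.exp_pos (15 / 32 * x ^ 2)).le) integrable_exp_sq_gaussian
    (Real.exp (15 / 32 * b ^ 2))
  rw [integral_exp_sq_gaussian] at h
  have hsub : (gaussianReal 0 1).real {x | b ≤ |x|} ≤
      (gaussianReal 0 1).real {x | Real.exp (15 / 32 * b ^ 2) ≤ Real.exp (15 / 32 * x ^ 2)} := by
    apply measureReal_mono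
    · intro x hx
      have hx' : b ≤ |x| := hx
      have := pow_le_pow_left₀ hb hx' 2
      rw [sq_abs] at this
      exact Real.exp_le_exp.2 (by linarith)
    · finiteness
  rw [neg_mul, Real.exp_neg, ← div_eq_mul_inv, le_div_iff₀ (Real.exp_pos _), mul_comm]
  exact (mul_le_mul_of_nonneg_left hsub (Real.exp_pos _).le).trans h

/-- On `|x| ≥ a` the gap `15/32 - 3/32 = 3/8` in the exponents is traded for the factor
`exp(-3a²/8)`, which is `exp(-3A/2)` when `a² = 4A`. -/
theorem exp_truncated_le {a : ℝ} (ha : 0 ≤ a) (x : ℝ) :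
    Real.exp (3 / 32 * (if a ≤ |x| then x ^ 2 else 0)) ≤
      1 + Real.exp (-(3 / 8) * a ^ 2) * Real.exp (15 / 32 * x ^ 2) := by
  split_ifs with h
  · have := pow_le_pow_left₀ ha h 2
    rw [sq_abs] at this
    rw [← Real.exp_add]
    have : Real.exp (3 / 32 * x ^ 2) ≤ Real.exp (-(3 / 8) * a ^ 2 + 15 / 32 * x ^ 2) :=
      Real.exp_le_exp.2 (by linarith)
    linarith
  · rw [mul_zero, Real.exp_zero]
    have := Real.exp_pos (-(3 / 8) * a ^ 2)
    have := Real.exp_pos (15 / 32 * x ^ 2)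
    nlinarith

theorem measurable_truncated (a : ℝ) :
    Measurable (fun x : ℝ => if a ≤ |x| then x ^ 2 else 0) :=
  Measurable.ite (measurableSet_le_abs a) (by fun_prop) measurable_const

theorem integrable_exp_truncated {a : ℝ} (ha : 0 ≤ a) :
    Integrable (fun x : ℝ => Real.exp (3 / 32 * (if a ≤ |x| then x ^ 2 else 0)))
      (gaussianReal 0 1) := by
  refine ((integrable_const (1 : ℝ)).add
    (integrable_exp_sq_gaussian.const_mul (Real.exp (-(3 / 8) * a ^ 2)))).mono'
    ((measurable_truncated a).const_mul _).exp.aestronglyMeasurable (ae_of_all _ fun x => ?_)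
  rw [Real.norm_of_nonneg (Real.exp_pos _).le]
  exact exp_truncated_le ha x

theorem integral_exp_truncated_le {a : ℝ} (ha : 0 ≤ a) :
    ∫ x, Real.exp (3 / 32 * (if a ≤ |x| then x ^ 2 else 0)) ∂(gaussianReal 0 1) ≤
      Real.exp (4 * Real.exp (-(3 / 8) * a ^ 2)) := by
  refine (integral_mono (integrable_exp_truncated ha) ((integrable_const (1 : ℝ)).add
    (integrable_exp_sq_gaussian.const_mul (Real.exp (-(3 / 8) * a ^ 2))))
    (exp_truncated_le ha)).trans ?_
  simp only [Pi.add_apply]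
  rw [integral_add (integrable_const _) (integrable_exp_sq_gaussian.const_mul _),
    integral_const_mul, integral_exp_sq_gaussian]
  simp only [integral_const, probReal_univ, smul_eq_mul, mul_one]
  have := Real.add_one_le_exp (4 * Real.exp (-(3 / 8) * a ^ 2))
  linarith

theorem one_le_integral_exp_truncated {a : ℝ} (ha : 0 ≤ a) :
    1 ≤ ∫ x, Real.exp (3 / 32 * (if a ≤ |x| then x ^ 2 else 0)) ∂(gaussianReal 0 1) := by
  have h := integral_mono (μ := gaussianReal 0 1) (integrable_const (1 : ℝ))
    (integrable_exp_truncated ha) (fun x => Real.one_le_exp (by split_ifs <;> positivity))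
  simpa using h

/-- A lower bound for the probability of an interval. -/
theorem gaussian_Ioc_ge {u w : ℝ} (hu : 0 ≤ u) (huw : u ≤ w) :
    (w - u) * (23 / 60 * Real.exp (-(w ^ 2 / 2))) ≤
      (gaussianReal 0 1).real (Set.Ioc u w) := by
  rw [measureReal_def, gaussianReal_apply_eq_integral _ one_ne_zero,
    ENNReal.toReal_ofReal (integral_nonneg fun x => gaussianPDFReal_nonneg _ _ _)]
  have hpi : (23 / 60 : ℝ) ≤ (Real.sqrt (2 * Real.pi))⁻¹ := by
    rw [le_inv_comm₀ (by norm_num) (Real.sqrt_pos.2 (by positivity))]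
    apply Real.sqrt_le_iff.2
    constructor
    · norm_num
    · have := Real.pi_lt_d2
      norm_num
      linarith
  have hb : ∀ x ∈ Set.Ioc u w, 23 / 60 * Real.exp (-(w ^ 2 / 2))
      ≤ gaussianPDFReal 0 1 x := by
    intro x hx
    rw [gaussianPDFReal_def]
    simp only [NNReal.coe_one, mul_one, sub_zero]
    have h1 : Real.exp (-(w ^ 2 / 2)) ≤ Real.exp (-x ^ 2 / 2) := by
      apply Real.exp_le_exp.2
      have := pow_le_pow_left₀ (hu.trans hx.1.le) hx.2 2
      linarith
    have h2 := mul_le_mul hpi h1 (Real.exp_pos _).le (by positivity)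
    linarith
  have h := setIntegral_mono_on (μ := volume) (integrableOn_const (by simp))
    (integrable_gaussianPDFReal 0 1).integrableOn measurableSet_Ioc hb
  rw [setIntegral_const, Real.volume_real_Ioc_of_le huw, smul_eq_mul] at h
  exact h

theorem gaussian_Iio_neg (h : ℝ) :
    (gaussianReal 0 1).real (Set.Iio (-h)) = (gaussianReal 0 1).real (Set.Ioi h) := by
  have hm := gaussianReal_map_neg (μ := 0) (v := 1)
  rw [neg_zero] at hm
  conv_rhs => rw [← hm]
  rw [map_measureReal_apply measurable_neg measurableSet_Ioi]
  congr 1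
  ext x
  simp

/-- By symmetry `(0, ∞)` has mass at most `1/2`, and on `(0, h]` with `h ≤ 1` the density is at
least `1/10`. -/
theorem gaussian_Ioi_le {h : ℝ} (h0 : 0 ≤ h) (h1 : h ≤ 1) :
    (gaussianReal 0 1).real (Set.Ioi h) ≤ 1 / 2 - h / 10 := by
  have e1 := gaussian_Iio_neg 0
  rw [neg_zero] at e1
  have hdisj : Disjoint (Set.Iio (0 : ℝ)) (Set.Ioi 0) :=
    Set.disjoint_left.2 fun x (hx : x < 0) (hx' : 0 < x) => lt_asymm hx hx'
  have e2 := measureReal_union (μ := gaussianReal 0 1) hdisj measurableSet_Ioi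
  have e3 : (gaussianReal 0 1).real (Set.Iio 0 ∪ Set.Ioi 0) ≤ 1 := measureReal_le_one
  have hdisj' : Disjoint (Set.Ioc 0 h) (Set.Ioi h) :=
    Set.disjoint_left.2 fun x hx hx' => not_lt.2 hx.2 hx'
  have e4 := measureReal_union (μ := gaussianReal 0 1) hdisj' measurableSet_Ioi
  rw [Set.Ioc_union_Ioi_eq_Ioi h0] at e4
  have e5 := gaussian_Ioc_ge le_rfl h0
  have e6 : (1 - 1 / 2 : ℝ) ≤ Real.exp (-(h ^ 2 / 2)) := by
    have := Real.add_one_le_exp (-(h ^ 2 / 2))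
    nlinarith
  have e7 : h * (1 / 10) ≤
      (h - 0) * (23 / 60 * Real.exp (-(h ^ 2 / 2))) := by
    rw [sub_zero]
    exact mul_le_mul_of_nonneg_left (by linarith) h0
  linarith

/-- Split at `|x| = 3a`: below it `x² ≤ 9a²`; above it `x² ≤ 8 exp(x²/8)`, and the remaining
`11x²/32` in the exponent exceeds `3a²`. -/
theorem sq_truncated_le {a : ℝ} (ha : 0 ≤ a) (x : ℝ) :
    {x : ℝ | a ≤ |x|}.indicator (fun x => x ^ 2) x ≤
      9 * a ^ 2 * {x : ℝ | a ≤ |x|}.indicator 1 x +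
        8 * Real.exp (-3 * a ^ 2) * Real.exp (15 / 32 * x ^ 2) := by
  by_cases h : a ≤ |x|
  · simp only [Set.indicator, Set.mem_ofPred_eq, h, if_true, Pi.one_apply, mul_one]
    by_cases h3 : 3 * a ≤ |x|
    · have h4 := pow_le_pow_left₀ (by positivity) h3 2
      rw [sq_abs] at h4
      rw [mul_assoc, ← Real.exp_add]
      have h5 : Real.exp (x ^ 2 / 8) ≤
          Real.exp (-3 * a ^ 2 + 15 / 32 * x ^ 2) :=
        Real.exp_le_exp.2 (by nlinarith)
      have := Real.add_one_le_exp (x ^ 2 / 8)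
      nlinarith [sq_nonneg a]
    · push Not at h3
      have h4 := pow_le_pow_left₀ (abs_nonneg x) h3.le 2
      rw [sq_abs] at h4
      have : 0 ≤ 8 * Real.exp (-3 * a ^ 2) * Real.exp (15 / 32 * x ^ 2) := by
        positivity
      linarith
  · simp only [Set.indicator, Set.mem_ofPred_eq, h, if_false, mul_zero, zero_add]
    positivity

theorem nu_le {a : ℝ} (ha : 2 ≤ a) : nu a ≤ 9 * a ^ 2 + 100 := by
  have ha0 : 0 ≤ a := by linarith
  set P := (gaussianReal 0 1).real {x : ℝ | a ≤ |x|} with hP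
  have hnu : nu a = P⁻¹ * ∫ x, {x : ℝ | a ≤ |x|}.indicator (fun x => x ^ 2) x
      ∂(gaussianReal 0 1) := by
    rw [nu, ProbabilityTheory.cond, integral_smul_measure,
      integral_indicator (measurableSet_le_abs a), ENNReal.toReal_inv, smul_eq_mul]
    rfl
  have hint : ∫ x, {x : ℝ | a ≤ |x|}.indicator (fun x => x ^ 2) x ∂(gaussianReal 0 1) ≤
      9 * a ^ 2 * P + 32 * Real.exp (-3 * a ^ 2) := by
    have hi1 : Integrable (fun x => 9 * a ^ 2 * {x : ℝ | a ≤ |x|}.indicator (1 : ℝ → ℝ) x)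
        (gaussianReal 0 1) :=
      ((integrable_const (1 : ℝ)).indicator (measurableSet_le_abs a)).const_mul _
    have hi2 := integrable_exp_sq_gaussian.const_mul
      (8 * Real.exp (-3 * a ^ 2))
    refine (integral_mono_of_nonneg (ae_of_all _ fun x => ?_) (hi1.add hi2)
      (ae_of_all _ (sq_truncated_le ha0))).trans (le_of_eq ?_)
    · exact Set.indicator_nonneg (fun x _ => sq_nonneg x) x
    · simp only [Pi.add_apply]
      rw [integral_add hi1 hi2, integral_const_mul, integral_const_mul, integral_exp_sq_gaussian,
        integral_indicator_one (measurableSet_le_abs a)]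
      ring
  -- Mass of `(a, a+1]`; `a ≥ 2` gives `a + 1 ≤ 3a/2`. Dividing by `P` then leaves `32 · 60/23 ≤
  -- 100`.
  have hPlow : 23 / 60 * Real.exp (-(9 / 8) * a ^ 2) ≤ P := by
    have h1 := gaussian_Ioc_ge ha0 (by linarith : a ≤ a + 1)
    have h2 : (gaussianReal 0 1).real (Set.Ioc a (a + 1)) ≤ P := by
      apply measureReal_mono _ (by finiteness)
      intro x hx
      exact hx.1.le.trans (le_abs_self x)
    have h3 : Real.exp (-(9 / 8) * a ^ 2) ≤ Real.exp (-((a + 1) ^ 2 / 2)) :=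
      Real.exp_le_exp.2 (by nlinarith)
    linarith
  have hP0 : 0 < P := lt_of_lt_of_le (by positivity) hPlow
  have hexp : Real.exp (-3 * a ^ 2) ≤ Real.exp (-(9 / 8) * a ^ 2) :=
    Real.exp_le_exp.2 (by nlinarith)
  rw [hnu, inv_mul_le_iff₀ hP0]
  linarith

/-! ### Independent normal variables -/

theorem measurePreserving_eval_gaussPi {p : ℕ} (j : Fin p) :
    MeasurePreserving (fun z : Fin p → ℝ => z j) (gaussPi p) (gaussianReal 0 1) :=
  measurePreserving_eval _ j

theorem integral_eval_gaussPi {p : ℕ} (j : Fin p) {f : ℝ → ℝ} (hf : Measurable f) :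
    ∫ z, f (z j) ∂(gaussPi p) = ∫ x, f x ∂(gaussianReal 0 1) := by
  rw [← (measurePreserving_eval_gaussPi j).map_eq,
    integral_map (measurable_pi_apply j).aemeasurable hf.aestronglyMeasurable]

theorem integrable_eval_gaussPi {p : ℕ} (j : Fin p) {f : ℝ → ℝ}
    (hf : Integrable f (gaussianReal 0 1)) : Integrable (fun z => f (z j)) (gaussPi p) :=
  (measurePreserving_eval_gaussPi j).integrable_comp_of_integrable hf

/-- An exponential upper bound for the sum of the squares exceeding a threshold. -/
theorem gaussPi_sum_truncated_tail {p : ℕ} {a : ℝ} (ha : 0 ≤ a) (r : ℝ) :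
    (gaussPi p).real {z | r < ∑ j, (if a ≤ |z j| then z j ^ 2 else 0)} ≤
      Real.exp (-(3 / 32) * r + p * (4 * Real.exp (-(3 / 8) * a ^ 2))) := by
  have hprod : ∫ z, ∏ j, Real.exp (3 / 32 * (if a ≤ |z j| then z j ^ 2 else 0)) ∂(gaussPi p) =
      (∫ x, Real.exp (3 / 32 * (if a ≤ |x| then x ^ 2 else 0)) ∂(gaussianReal 0 1)) ^ p := by
    rw [gaussPi, integral_fintype_prod_eq_prod (f := fun _ (x : ℝ) =>
      Real.exp (3 / 32 * (if a ≤ |x| then x ^ 2 else 0)))]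
    simp
  have hone := one_le_integral_exp_truncated ha
  have hint : Integrable (fun z : Fin p → ℝ =>
      ∏ j, Real.exp (3 / 32 * (if a ≤ |z j| then z j ^ 2 else 0))) (gaussPi p) :=
    Integrable.of_integral_ne_zero (by rw [hprod]; positivity)
  have h := mul_meas_ge_le_integral_of_nonneg (μ := gaussPi p) (ae_of_all _ fun z =>
    Finset.prod_nonneg fun j _ => (Real.exp_pos _).le) hint (Real.exp (3 / 32 * r))
  have hpow := pow_le_pow_left₀ (by linarith) (integral_exp_truncated_le ha) p
  rw [← Real.exp_nat_mul] at hpow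
  have hsub : (gaussPi p).real {z | r < ∑ j, (if a ≤ |z j| then z j ^ 2 else 0)} ≤
      (gaussPi p).real {z | Real.exp (3 / 32 * r) ≤
        ∏ j, Real.exp (3 / 32 * (if a ≤ |z j| then z j ^ 2 else 0))} := by
    apply measureReal_mono _ (by finiteness)
    intro z hz
    have hz' : r < ∑ j, (if a ≤ |z j| then z j ^ 2 else 0) := hz
    rw [Set.mem_ofPred_eq, ← Real.exp_sum, ← Finset.mul_sum]
    exact Real.exp_le_exp.2 (by linarith)
  rw [Real.exp_add, neg_mul, Real.exp_neg, inv_mul_eq_div, le_div_iff₀ (Real.exp_pos _), mul_comm]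
  exact (mul_le_mul_of_nonneg_left hsub (Real.exp_pos _).le).trans
    (h.trans (hprod.le.trans hpow))

/-- Hoeffding's inequality for the number of coordinates lying in a set. -/
theorem gaussPi_card_tail {p : ℕ} {B : Set ℝ} (hB : MeasurableSet B) {x : ℝ} (hx : 0 ≤ x) :
    (gaussPi p).real {z | p * (gaussianReal 0 1).real B + x ≤ ∑ j, B.indicator 1 (z j)} ≤
      Real.exp (-2 * x ^ 2 / p) := by
  have hmeas : Measurable (B.indicator (1 : ℝ → ℝ)) := measurable_one.indicator hB
  have hmean : ∫ y, B.indicator (1 : ℝ → ℝ) y ∂(gaussianReal 0 1) = (gaussianReal 0 1).real B :=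
    integral_indicator_one hB
  have hindep : iIndepFun (fun (j : Fin p) (z : Fin p → ℝ) =>
      B.indicator (1 : ℝ → ℝ) (z j) - (gaussianReal 0 1).real B) (gaussPi p) :=
    iIndepFun_pi (X := fun _ y => B.indicator (1 : ℝ → ℝ) y - (gaussianReal 0 1).real B)
      fun _ => (hmeas.sub_const _).aemeasurable
  have hsub : ∀ j ∈ (Finset.univ : Finset (Fin p)), HasSubgaussianMGF (fun z : Fin p → ℝ =>
      B.indicator (1 : ℝ → ℝ) (z j) - (gaussianReal 0 1).real B) ((‖(1 : ℝ) - 0‖₊ / 2) ^ 2)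
      (gaussPi p) := by
    intro j _
    have h := hasSubgaussianMGF_of_mem_Icc (μ := gaussPi p) (a := 0) (b := 1)
      (X := fun z : Fin p → ℝ => B.indicator (1 : ℝ → ℝ) (z j))
      (hmeas.comp (measurable_pi_apply j)).aemeasurable
      (ae_of_all _ fun z => by
        by_cases hz : z j ∈ B <;> simp [Set.indicator, hz])
    rwa [integral_eval_gaussPi j hmeas, hmean] at h
  have h := HasSubgaussianMGF.measure_sum_ge_le_of_iIndepFun hindep hsub hx
  have e : {z : Fin p → ℝ | p * (gaussianReal 0 1).real B + x ≤ ∑ j, B.indicator 1 (z j)} =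
      {z | x ≤ ∑ j, (B.indicator (1 : ℝ → ℝ) (z j) - (gaussianReal 0 1).real B)} := by
    ext z
    simp only [Set.mem_ofPred_eq, Finset.sum_sub_distrib, Finset.sum_const, Finset.card_univ,
      Fintype.card_fin, nsmul_eq_mul]
    constructor <;> intro h <;> linarith
  rw [e]
  refine h.trans (le_of_eq ?_)
  congr 1
  simp only [Finset.sum_const, Finset.card_univ, Fintype.card_fin, nsmul_eq_mul, sub_zero,
    nnnorm_one, NNReal.coe_mul, NNReal.coe_natCast, NNReal.coe_pow, NNReal.coe_div, NNReal.coe_one,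
    NNReal.coe_ofNat]
  rcases eq_or_ne (p : ℝ) 0 with hp | hp
  · simp [hp]
  · field_simp

theorem card_add_le_card_add_card {p : ℕ} (v z : Fin p → ℝ) (B : Set ℝ) [DecidablePred (· ∈ B)] :
    ((Finset.univ.filter fun j => v j + z j ∈ B).card : ℝ) ≤
      (Finset.univ.filter fun j => v j ≠ 0).card + ∑ j, B.indicator (1 : ℝ → ℝ) (z j) := by
  rw [Finset.card_filter, Finset.card_filter]
  push_cast
  rw [← Finset.sum_add_distrib]
  refine Finset.sum_le_sum fun j _ => ?_
  by_cases hv : v j = 0 <;> by_cases hz : z j ∈ B <;> simp [Set.indicator, hv, hz]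
  all_goals split_ifs <;> norm_num

/-- The median of a sparse shift of independent normal variables is close to `0`. -/
theorem gaussPi_median_tail {p s : ℕ} (hp : 0 < p) {η L : ℝ} (h0 : 0 ≤ η) (h1 : η ≤ 1)
    (hL : 0 ≤ L) (hη : s + Real.sqrt (p * L) ≤ p * η / 10) {v : Fin p → ℝ}
    (hv : (Finset.univ.filter fun j => v j ≠ 0).card ≤ s) :
    (gaussPi p).real {z | η < |median (fun j => v j + z j)|} ≤ 2 * Real.exp (-2 * L) := by
  classical
  have hp' : (0 : ℝ) < p := by exact_mod_cast hp
  have hv' : ((Finset.univ.filter fun j => v j ≠ 0).card : ℝ) ≤ s := by exact_mod_cast hv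
  have hexp : Real.exp (-2 * Real.sqrt (p * L) ^ 2 / p) = Real.exp (-2 * L) := by
    rw [Real.sq_sqrt (by positivity)]
    congr 1
    field_simp
  have hq := gaussian_Ioi_le h0 h1
  have hq' := hq
  rw [← gaussian_Iio_neg] at hq'
  -- At most `s` coordinates are shifted, so at least `p/2 - s` of the `z_j` lie in `B`: an excess
  -- over the mean of at least `pη/10 - s ≥ √(pL)`.
  have key : ∀ (B : Set ℝ) (z : Fin p → ℝ), (gaussianReal 0 1).real B ≤ 1 / 2 - η / 10 →
      (p : ℝ) / 2 ≤ ((Finset.univ.filter fun j => v j + z j ∈ B).card : ℝ) →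
      p * (gaussianReal 0 1).real B + Real.sqrt (p * L) ≤ ∑ j, B.indicator 1 (z j) := by
    intro B z hB hz
    have h2 := card_add_le_card_add_card v z B
    have h3 := mul_le_mul_of_nonneg_left hB hp'.le
    linarith
  have hsub : {z : Fin p → ℝ | η < |median (fun j => v j + z j)|} ⊆
      {z | p * (gaussianReal 0 1).real (Set.Ioi η) + Real.sqrt (p * L) ≤
        ∑ j, (Set.Ioi η).indicator 1 (z j)} ∪
      {z | p * (gaussianReal 0 1).real (Set.Iio (-η)) + Real.sqrt (p * L) ≤
        ∑ j, (Set.Iio (-η)).indicator 1 (z j)} := by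
    intro z hz
    rcases lt_abs.1 (show η < |median (fun j => v j + z j)| from hz) with h | h
    · exact Or.inl (key _ z hq (half_le_card_of_lt_median hp _ h))
    · exact Or.inr (key _ z hq' (half_le_card_of_median_lt hp _ (by linarith)))
  have hA := gaussPi_card_tail (p := p) (measurableSet_Ioi (a := η))
    (Real.sqrt_nonneg (p * L))
  have hB := gaussPi_card_tail (p := p) (measurableSet_Iio (a := -η))
    (Real.sqrt_nonneg (p * L))
  rw [hexp] at hA hB
  have := (measureReal_mono (μ := gaussPi p) hsub (by finiteness)).trans
    (measureReal_union_le _ _)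
  linarith

/-- A Markov bound for the noise on the support and the number of large coordinates. -/
theorem gaussPi_noise_tail {p s : ℕ} {b K : ℝ} (hb : 0 ≤ b) (hK : 0 < K) {S : Finset (Fin p)}
    (hS : S.card ≤ s) :
    (gaussPi p).real {z | K < ∑ j ∈ S, z j ^ 2 + ∑ j, {x : ℝ | b ≤ |x|}.indicator 1 (z j)} ≤
      (s + p * (4 * Real.exp (-(15 / 32) * b ^ 2))) / K := by
  have hsq : Integrable (fun x : ℝ => x ^ 2) (gaussianReal 0 1) :=
    (memLp_id_gaussianReal 2).integrable_sq
  have hsq1 : ∫ x : ℝ, x ^ 2 ∂(gaussianReal 0 1) = 1 := by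
    have h := variance_of_integral_eq_zero (μ := gaussianReal 0 1) (X := id) aemeasurable_id
      (by simp)
    rw [variance_id_gaussianReal] at h
    simpa using h.symm
  have hind : Integrable ({x : ℝ | b ≤ |x|}.indicator (1 : ℝ → ℝ)) (gaussianReal 0 1) :=
    (integrable_const (1 : ℝ)).indicator (measurableSet_le_abs b)
  have hi1 : Integrable (fun z : Fin p → ℝ => ∑ j ∈ S, z j ^ 2) (gaussPi p) :=
    integrable_finsetSum _ fun j _ => integrable_eval_gaussPi j hsq
  have hi2 : Integrable (fun z : Fin p → ℝ =>
      ∑ j, {x : ℝ | b ≤ |x|}.indicator (1 : ℝ → ℝ) (z j)) (gaussPi p) :=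
    integrable_finsetSum _ fun j _ => integrable_eval_gaussPi j hind
  have hind0 : ∀ x : ℝ, 0 ≤ {x : ℝ | b ≤ |x|}.indicator (1 : ℝ → ℝ) x := fun x =>
    Set.indicator_nonneg (fun _ _ => zero_le_one) x
  have h := mul_meas_ge_le_integral_of_nonneg (μ := gaussPi p) (ae_of_all _ fun z =>
    add_nonneg (Finset.sum_nonneg fun j (_ : j ∈ S) => sq_nonneg (z j))
      (Finset.sum_nonneg fun j (_ : j ∈ Finset.univ) => hind0 (z j))) (hi1.add hi2) K
  have hmean : ∫ z, (∑ j ∈ S, z j ^ 2 + ∑ j, {x : ℝ | b ≤ |x|}.indicator (1 : ℝ → ℝ) (z j))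
      ∂(gaussPi p) ≤ s + p * (4 * Real.exp (-(15 / 32) * b ^ 2)) := by
    rw [integral_add hi1 hi2, integral_finsetSum _ fun j _ => integrable_eval_gaussPi j hsq,
      integral_finsetSum _ fun j _ => integrable_eval_gaussPi j hind]
    have e1 : ∀ j : Fin p, ∫ z, z j ^ 2 ∂(gaussPi p) = 1 := fun j => by
      rw [integral_eval_gaussPi j (f := fun x => x ^ 2) (by fun_prop), hsq1]
    have e2 : ∀ j : Fin p, ∫ z, {x : ℝ | b ≤ |x|}.indicator (1 : ℝ → ℝ) (z j) ∂(gaussPi p)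
        = (gaussianReal 0 1).real {x | b ≤ |x|} := fun j => by
      rw [integral_eval_gaussPi j (measurable_one.indicator (measurableSet_le_abs b)),
        integral_indicator_one (measurableSet_le_abs b)]
    simp only [e1, e2, Finset.sum_const, nsmul_eq_mul, mul_one, Finset.card_univ, Fintype.card_fin]
    have hS' : (S.card : ℝ) ≤ s := by exact_mod_cast hS
    have := mul_le_mul_of_nonneg_left (gaussian_abs_tail hb) (Nat.cast_nonneg (α := ℝ) p)
    linarith
  rw [le_div_iff₀ hK, mul_comm]
  refine le_trans (mul_le_mul_of_nonneg_left ?_ hK.le) (h.trans hmean)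
  refine measureReal_mono (fun z hz => ?_) (by finiteness)
  exact (show K < _ from hz).le

/-! ### The rates -/

theorem log_pos_of_two_le {n : ℕ} (hn : 2 ≤ n) : 0 < Real.log (8 * (n : ℝ)) := by
  have : (2 : ℝ) ≤ n := by exact_mod_cast hn
  exact Real.log_pos (by linarith)

theorem exp_loglog {n : ℕ} (hn : 2 ≤ n) : Real.exp (loglog n) = Real.log (8 * (n : ℝ)) :=
  Real.exp_log (log_pos_of_two_le hn)

theorem one_le_loglog {n : ℕ} (hn : 2 ≤ n) : 1 ≤ loglog n := by
  have h2 : (2 : ℝ) ≤ n := by exact_mod_cast hn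
  rw [loglog, Real.le_log_iff_exp_le (log_pos_of_two_le hn)]
  -- Already at `n = 2`, `log 16 = 4 log 2 > e`.
  have h16 : Real.log (2 ^ 4) ≤ Real.log (8 * (n : ℝ)) :=
    Real.log_le_log (by norm_num) (by linarith)
  rw [Real.log_pow] at h16
  have := Real.log_two_gt_d9
  have := Real.exp_one_lt_d9
  push_cast at h16
  linarith

theorem pow_five_le {s : ℕ} {x : ℝ} (hx : 0 ≤ x) (h : (s : ℝ) ≤ x ^ ((1 : ℝ) / 5)) :
    (s : ℝ) ^ 5 ≤ x := by
  have h1 := pow_le_pow_left₀ (Nat.cast_nonneg s) h 5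
  rw [← Real.rpow_natCast (x ^ ((1 : ℝ) / 5)), ← Real.rpow_mul hx] at h1
  norm_num at h1
  exact h1

theorem sq_le_of_pow_five_le {s : ℕ} {x : ℝ} (hs : 1 ≤ s) (h : (s : ℝ) ^ 5 ≤ x) :
    (s : ℝ) ^ 2 ≤ x :=
  (pow_le_pow_right₀ (by exact_mod_cast hs) (by norm_num)).trans h

theorem one_le_logTerm {p n s : ℕ} (hs : 1 ≤ s) (h : (s : ℝ) ^ 5 ≤ p * loglog n) :
    1 ≤ logTerm p n s := by
  have hs' : (0 : ℝ) < (s : ℝ) ^ 2 := by positivity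
  have h2 := sq_le_of_pow_five_le hs h
  have : Real.exp 1 ≤ Real.exp 1 * (p : ℝ) * loglog n / (s : ℝ) ^ 2 := by
    rw [le_div_iff₀ hs', mul_assoc]
    exact mul_le_mul_of_nonneg_left h2 (Real.exp_pos 1).le
  rw [logTerm, Real.le_log_iff_exp_le (lt_of_lt_of_le (Real.exp_pos 1) this)]
  exact this

theorem mul_exp_logTerm_le {p n s : ℕ} (hs : 1 ≤ s) (hp : 0 < p) (hL : 1 ≤ loglog n)
    (h : (s : ℝ) ^ 5 ≤ p * loglog n) :
    (p : ℝ) * Real.exp (-(3 / 2) * logTerm p n s) ≤ s := by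
  have hs' : (1 : ℝ) ≤ s := by exact_mod_cast hs
  have hp' : (0 : ℝ) < p := by exact_mod_cast hp
  have hL0 : 0 < loglog n := by linarith
  have hpos : 0 < Real.exp 1 * (p : ℝ) * loglog n / (s : ℝ) ^ 2 := by positivity
  -- Squaring turns the exponent `3/2` into a cube; what remains follows from `s⁴ ≤ p L`.
  apply le_of_sq_le_sq _ (by linarith)
  have e : Real.exp (-(3 / 2) * logTerm p n s) ^ 2 =
      ((s : ℝ) ^ 2 / (Real.exp 1 * (p : ℝ) * loglog n)) ^ 3 := by
    rw [← Real.exp_nat_mul, show ((2 : ℕ) : ℝ) * (-(3 / 2) * logTerm p n s)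
      = ((3 : ℕ) : ℝ) * -logTerm p n s by push_cast; ring, Real.exp_nat_mul, Real.exp_neg, logTerm,
      Real.exp_log hpos, inv_div]
  rw [mul_pow, e, div_pow, mul_div_assoc', div_le_iff₀ (by positivity)]
  have he : (1 : ℝ) ≤ Real.exp 1 ^ 3 := one_le_pow₀ (Real.one_le_exp zero_le_one)
  have h4 : (s : ℝ) ^ 4 ≤ p * loglog n := (pow_le_pow_right₀ hs' (by norm_num)).trans h
  calc (p : ℝ) ^ 2 * ((s : ℝ) ^ 2) ^ 3 = (p : ℝ) ^ 2 * (s : ℝ) ^ 2 * (s : ℝ) ^ 4 := by ring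
    _ ≤ (p : ℝ) ^ 2 * (s : ℝ) ^ 2 * (p * loglog n) := by gcongr
    _ = 1 * ((s : ℝ) ^ 2 * (p : ℝ) ^ 3 * loglog n) * 1 ^ 2 := by ring
    _ ≤ Real.exp 1 ^ 3 * ((s : ℝ) ^ 2 * (p : ℝ) ^ 3 * loglog n) * loglog n ^ 2 := by gcongr
    _ = (s : ℝ) ^ 2 * (Real.exp 1 * p * loglog n) ^ 3 := by ring

/-! ### The dyadic grid and the mean of the CUSUM vectors -/

theorem pos_and_two_mul_le_of_mem_grid {n t : ℕ} (hn : 2 ≤ n) (ht : t ∈ grid n) :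
    0 < t ∧ 2 * t ≤ n := by
  simp only [grid, Finset.mem_image, Finset.mem_range] at ht
  obtain ⟨k, hk, rfl⟩ := ht
  refine ⟨by positivity, ?_⟩
  have h1 : 2 ^ k ≤ n / 2 := (Nat.pow_le_pow_right (by norm_num) (by omega)).trans
    (Nat.pow_log_le_self 2 (by omega : n / 2 ≠ 0))
  omega

theorem card_grid_le {n : ℕ} (hn : 2 ≤ n) :
    ((grid n).card : ℝ) ≤ 2 * Real.log (8 * (n : ℝ)) := by
  have h1 : (grid n).card ≤ Nat.log 2 (n / 2) + 1 :=
    Finset.card_image_le.trans (Finset.card_range _).le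
  have h2 : 2 ^ (Nat.log 2 (n / 2) + 1) ≤ n := by
    have := Nat.pow_log_le_self 2 (by omega : n / 2 ≠ 0)
    rw [pow_succ]
    omega
  have h3 : ((2 : ℝ)) ^ (Nat.log 2 (n / 2) + 1) ≤ n := by exact_mod_cast h2
  have h4 := Real.log_le_log (by positivity) (h3.trans (by linarith [Nat.cast_nonneg (α := ℝ) n] :
    (n : ℝ) ≤ 8 * n))
  rw [Real.log_pow] at h4
  have h5 := Real.log_two_gt_d9
  have h6 : ((grid n).card : ℝ) ≤ ((Nat.log 2 (n / 2) + 1 : ℕ) : ℝ) := by exact_mod_cast h1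
  have h7 : (0 : ℝ) ≤ ((Nat.log 2 (n / 2) + 1 : ℕ) : ℝ) := by positivity
  nlinarith

theorem exists_mem_grid {n t₀ : ℕ} (h : t₀ ∈ Finset.Icc 1 (n - 1)) :
    ∃ t ∈ grid n, t ≤ t₀ ∧ t₀ + t ≤ n ∧
      (t₀ : ℝ) * ((n : ℝ) - t₀) / n ≤ 2 * t := by
  rw [Finset.mem_Icc] at h
  -- The largest power of two below `m` keeps both blocks on their own side of the change and
  -- exceeds `m/2`, while `t₀(n - t₀)/n ≤ m`.
  set m := min t₀ (n - t₀) with hm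
  have hm0 : m ≠ 0 := by omega
  have h1 := Nat.pow_log_le_self 2 hm0
  have h2 := Nat.lt_pow_succ_log_self (b := 2) (by norm_num) m
  rw [pow_succ] at h2
  refine ⟨2 ^ Nat.log 2 m, ?_, by omega, by omega, ?_⟩
  · exact Finset.mem_image.2 ⟨Nat.log 2 m, Finset.mem_range.2
      (Nat.lt_succ_of_le (Nat.log_mono_right (by omega))), rfl⟩
  · have hn : (0 : ℝ) < n := by exact_mod_cast (by omega : 0 < n)
    have hsub : ((n - t₀ : ℕ) : ℝ) = (n : ℝ) - t₀ := Nat.cast_sub (by omega)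
    have h3 : (m : ℝ) ≤ 2 * ((2 ^ Nat.log 2 m : ℕ) : ℝ) := by
      have : m ≤ 2 * 2 ^ Nat.log 2 m := by omega
      exact_mod_cast this
    refine le_trans ?_ h3
    rw [div_le_iff₀ hn, hm, Nat.cast_min, hsub]
    have ht : (0 : ℝ) ≤ t₀ := Nat.cast_nonneg _
    have ht' : (0 : ℝ) ≤ (n : ℝ) - t₀ := hsub ▸ Nat.cast_nonneg _
    rcases le_total (t₀ : ℝ) ((n : ℝ) - t₀) with hle | hle
    · rw [min_eq_left hle]; nlinarith
    · rw [min_eq_right hle]; nlinarith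

theorem cusum_eq_of_two_levels {p n t : ℕ} (htn : t ≤ n) {θ : Data p n}
    {μ₁ μ₂ : EuclideanSpace ℝ (Fin p)} (h1 : ∀ i : Fin n, (i : ℕ) < t → θ i = μ₁)
    (h2 : ∀ i : Fin n, n - t ≤ (i : ℕ) → θ i = μ₂) :
    cusum θ t = ((Real.sqrt (2 * (t : ℝ)))⁻¹ * t) • (μ₁ - μ₂) := by
  rw [cusum, Finset.sum_congr rfl fun i hi => h1 i (Finset.mem_filter.1 hi).2,
    Finset.sum_congr rfl fun i hi => h2 i (Finset.mem_filter.1 hi).2, Finset.sum_const,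
    Finset.sum_const, card_filter_lt htn, card_filter_sub_le htn, ← smul_sub, mul_smul,
    Nat.cast_smul_eq_nsmul]

theorem sq_cusum_factor {t : ℕ} (ht : 0 < t) :
    ((Real.sqrt (2 * (t : ℝ)))⁻¹ * t) ^ 2 = t / 2 := by
  have : (t : ℝ) ≠ 0 := by positivity
  rw [mul_pow, inv_pow, Real.sq_sqrt (by positivity)]
  field_simp

/-! ### Behaviour of the statistic at a fixed time -/

theorem sum_robustThresh_le {p : ℕ} {a η x : ℝ} (z : Fin p → ℝ) (hx : |x| ≤ η) :
    ∑ j, robustThresh a η (z j - x) ≤ ∑ j, (if a ≤ |z j| then z j ^ 2 else 0) :=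
  Finset.sum_le_sum fun j _ =>
    (robustThresh_le (by rwa [sub_sub_cancel])).trans (thresh_le a (z j))

/-- Every competitor in the infimum is `v + z + e` with `|e| ≤ 2η ≤ 2`. Off the support it can reach
the threshold only if `|z| ≥ a - 2η`; on it, `(v + z + e)² ≥ v²/2 - 2z² - 2e²`, whence the `8`. -/
theorem robustThresh_shift_ge {a η x v z : ℝ} (hη : η ≤ 1) (hx : |x| ≤ η) :
    v ^ 2 / 2 - (if v ≠ 0 then 2 * z ^ 2 + 8 + max (nu a) (a ^ 2) else 0) -
        max (nu a) (a ^ 2) * {x : ℝ | a - 2 * η ≤ |x|}.indicator 1 z ≤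
      robustThresh a η (v + z - x) := by
  have hM : 0 ≤ max (nu a) (a ^ 2) := (nu_nonneg a).trans (le_max_left _ _)
  refine le_robustThresh ((abs_nonneg x).trans hx) fun y hy => ?_
  set e := y - (v + z) with he
  have hev : |e| ≤ 2 * η := by
    have : e = (y - (v + z - x)) - x := by rw [he]; ring
    rw [this]
    exact (abs_sub _ _).trans (by linarith)
  by_cases hv : v = 0
  · simp only [hv, ne_eq, not_true, if_false]
    by_cases hz : a - 2 * η ≤ |z|
    · simp only [Set.indicator, Set.mem_ofPred_eq, hz, if_true, Pi.one_apply]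
      have := neg_le_thresh a y
      linarith
    · simp only [Set.indicator, Set.mem_ofPred_eq, hz, if_false]
      rw [thresh_eq_zero]
      · norm_num
      · have : y = z + e := by rw [he, hv]; ring
        rw [this]
        push Not at hz
        exact (abs_add_le _ _).trans_lt (by linarith)
  · simp only [hv, ne_eq, not_false_eq_true, if_true]
    have hind : 0 ≤ {x : ℝ | a - 2 * η ≤ |x|}.indicator (1 : ℝ → ℝ) z :=
      Set.indicator_nonneg (fun _ _ => zero_le_one) z
    have h1 := sq_sub_le_thresh a y
    have h2 : e ^ 2 ≤ 2 ^ 2 := by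
      rw [← sq_abs]
      exact pow_le_pow_left₀ (abs_nonneg e) (by linarith) 2
    have h3 : y = v + (z + e) := by rw [he]; ring
    have h4 : v ^ 2 / 2 - 2 * z ^ 2 - 2 * e ^ 2 ≤ y ^ 2 := by
      rw [h3]
      nlinarith [sq_nonneg (v + 2 * (z + e)), sq_nonneg (z - e)]
    have := mul_nonneg hM hind
    linarith

theorem sum_robustThresh_shift_ge {p s : ℕ} {a η x K : ℝ} (hη : η ≤ 1) (hx : |x| ≤ η)
    {v z : Fin p → ℝ} (hv : (Finset.univ.filter fun j => v j ≠ 0).card ≤ s)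
    (hK : ∑ j ∈ Finset.univ.filter (fun j => v j ≠ 0), z j ^ 2 +
      ∑ j, {x : ℝ | a - 2 * η ≤ |x|}.indicator 1 (z j) ≤ K) :
    (∑ j, v j ^ 2) / 2 - (2 + max (nu a) (a ^ 2)) * K - (8 + max (nu a) (a ^ 2)) * s ≤
      ∑ j, robustThresh a η (v j + z j - x) := by
  have hM : 0 ≤ max (nu a) (a ^ 2) := (nu_nonneg a).trans (le_max_left _ _)
  refine le_trans ?_ (Finset.sum_le_sum fun j _ =>
    robustThresh_shift_ge (a := a) (v := v j) (z := z j) hη hx)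
  rw [Finset.sum_sub_distrib, Finset.sum_sub_distrib, ← Finset.sum_div, ← Finset.mul_sum,
    ← Finset.sum_filter]
  simp only [add_assoc]
  rw [Finset.sum_add_distrib, ← Finset.mul_sum, Finset.sum_const, nsmul_eq_mul]
  have h1 : 0 ≤ ∑ j ∈ Finset.univ.filter (fun j => v j ≠ 0), z j ^ 2 :=
    Finset.sum_nonneg fun j _ => sq_nonneg _
  have h2 : 0 ≤ ∑ j, {x : ℝ | a - 2 * η ≤ |x|}.indicator (1 : ℝ → ℝ) (z j) :=
    Finset.sum_nonneg fun j _ => Set.indicator_nonneg (fun _ _ => zero_le_one) _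
  have h3 : ((Finset.univ.filter fun j => v j ≠ 0).card : ℝ) ≤ s := by exact_mod_cast hv
  have h4 := mul_le_mul_of_nonneg_right h3 (by linarith : 0 ≤ 8 + max (nu a) (a ^ 2))
  have h5 := mul_le_mul_of_nonneg_left hK (by linarith : 0 ≤ 2 + max (nu a) (a ^ 2))
  nlinarith [mul_nonneg hM h1]

/-! ### Error probabilities -/

theorem radius_le_one {L q : ℝ} (h : L / q ≤ 1 / 400) : 20 * Real.sqrt (L / q) ≤ 1 := by
  have h1 : Real.sqrt (L / q) ≤ 1 / 20 := Real.sqrt_le_iff.2 ⟨by norm_num, by linarith⟩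
  linarith

/-- This fixes the constant `20`: the right side is `2√(pL)`, and `s ≤ √(pL)`. Requiring the radius
to be at most `1` then gives `1/400`. -/
theorem add_sqrt_le_radius {p s : ℕ} (hp : 0 < p) (hs : 1 ≤ s) {L : ℝ}
    (h : (s : ℝ) ^ 5 ≤ p * L) :
    s + Real.sqrt (p * L) ≤ p * (20 * Real.sqrt (L / p)) / 10 := by
  have hp' : (0 : ℝ) < p := by exact_mod_cast hp
  have e : p * Real.sqrt (L / p) = Real.sqrt (p * L) := by
    rw [show (p : ℝ) * L = p ^ 2 * (L / p) by field_simp, Real.sqrt_mul (by positivity) (L / p),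
      Real.sqrt_sq hp'.le]
  have h1 : (s : ℝ) ≤ Real.sqrt (p * L) := Real.le_sqrt_of_sq_le (sq_le_of_pow_five_le hs h)
  linarith

theorem measurableSet_sum_robustThresh (p : ℕ) {a η : ℝ} (hη : 0 ≤ η) (r : ℝ) :
    MeasurableSet {y : Fin p → ℝ | r < ∑ j, robustThresh a η (y j)} :=
  measurableSet_lt measurable_const (Finset.measurable_sum _ fun j _ =>
    (measurable_robustThresh hη).comp (measurable_pi_apply j))

theorem gaussPi_null_tail {p n s : ℕ} {r : ℝ} (hp : 0 < p) (hs : 1 ≤ s) (hL : 1 ≤ loglog n)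
    (h5 : (s : ℝ) ^ 5 ≤ p * loglog n) (hc : loglog n / (p : ℝ) ≤ 1 / 400)
    (hr : 128 * sparseRate p n s ≤ r) :
    (gaussPi p).real {z | r < ∑ j, robustThresh (Real.sqrt (4 * logTerm p n s))
      (20 * Real.sqrt (loglog n / (p : ℝ))) (z j - median z)} ≤
      3 * Real.exp (-2 * loglog n) := by
  set a := Real.sqrt (4 * logTerm p n s) with ha
  have hA := one_le_logTerm hs h5
  have ha2 : a ^ 2 = 4 * logTerm p n s := Real.sq_sqrt (by linarith)
  have hsub : {z : Fin p → ℝ | r < ∑ j, robustThresh a (20 * Real.sqrt (loglog n / (p : ℝ)))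
      (z j - median z)} ⊆ {z | 20 * Real.sqrt (loglog n / (p : ℝ)) < |median fun j => 0 + z j|} ∪
      {z | r < ∑ j, (if a ≤ |z j| then z j ^ 2 else 0)} := by
    intro z hz
    simp only [zero_add, Set.mem_union, Set.mem_ofPred_eq]
    by_contra! hcon
    exact absurd (show r < _ from hz) (not_lt.2 ((sum_robustThresh_le z hcon.1).trans hcon.2))
  have h1 := gaussPi_median_tail (s := s) (v := fun _ => 0) hp
    (by positivity : 0 ≤ 20 * Real.sqrt (loglog n / (p : ℝ))) (radius_le_one hc)
    (by linarith) (add_sqrt_le_radius hp hs h5) (by simp)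
  have h2 := gaussPi_sum_truncated_tail (p := p) (Real.sqrt_nonneg (4 * logTerm p n s)) r
  rw [← ha, ha2, show -(3 / 8) * (4 * logTerm p n s) = -(3 / 2) * logTerm p n s by ring] at h2
  have h3 := mul_exp_logTerm_le hs hp hL h5
  have hs' : (0 : ℝ) ≤ s := Nat.cast_nonneg s
  have h4 : (s : ℝ) ≤ sparseRate p n s :=
    (le_mul_of_one_le_right hs' hA).trans (le_max_left _ _)
  have h6 : loglog n ≤ sparseRate p n s := le_max_right _ _
  have h7 : Real.exp (-(3 / 32) * r + p * (4 * Real.exp (-(3 / 2) * logTerm p n s))) ≤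
      Real.exp (-2 * loglog n) := Real.exp_le_exp.2 (by linarith)
  have := (measureReal_mono (μ := gaussPi p) hsub (by finiteness)).trans
    (measureReal_union_le _ _)
  linarith

theorem gaussPi_alternative_tail {p n s : ℕ} {r ε C : ℝ} (hp : 0 < p) (hs : 1 ≤ s)
    (hL : 1 ≤ loglog n) (h5 : (s : ℝ) ^ 5 ≤ p * loglog n)
    (hc : loglog n / (p : ℝ) ≤ 1 / 400) (hε : 0 < ε)
    (hC : 128 + 46 * (4 * (1 + 4 * Real.exp (15 / 2)) / ε) ≤ C)
    (hr : r = C * sparseRate p n s) {v : Fin p → ℝ}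
    (hv : (Finset.univ.filter fun j => v j ≠ 0).card ≤ s)
    (hvr : 8 * C * sparseRate p n s ≤ ∑ j, v j ^ 2) :
    (gaussPi p).real {z | ∑ j, robustThresh (Real.sqrt (4 * logTerm p n s))
      (20 * Real.sqrt (loglog n / (p : ℝ))) (v j + z j - median (fun k => v k + z k)) ≤ r} ≤
      2 * Real.exp (-2 * loglog n) + ε / 4 := by
  set a := Real.sqrt (4 * logTerm p n s) with ha
  set η := 20 * Real.sqrt (loglog n / (p : ℝ)) with hη
  set B := 4 * (1 + 4 * Real.exp (15 / 2)) / ε with hB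
  have hA := one_le_logTerm hs h5
  have ha2 : a ^ 2 = 4 * logTerm p n s := Real.sq_sqrt (by linarith)
  have ha2' : 2 ≤ a := Real.le_sqrt_of_sq_le (by linarith)
  have hη0 : 0 ≤ η := by positivity
  have hη1 : η ≤ 1 := radius_le_one hc
  have hs1 : (1 : ℝ) ≤ s := by exact_mod_cast hs
  have hs' : (0 : ℝ) < s := by linarith
  have hB0 : 0 < B := by positivity
  have hM : max (nu a) (a ^ 2) ≤ 136 * logTerm p n s := by
    have := nu_le ha2'
    exact max_le (by linarith) (by linarith)
  have hrate : s * logTerm p n s ≤ sparseRate p n s := le_max_left _ _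
  have hsub : {z : Fin p → ℝ | ∑ j, robustThresh a η (v j + z j - median (fun k => v k + z k)) ≤ r}
      ⊆ {z | η < |median fun k => v k + z k|} ∪
        {z | B * s < ∑ j ∈ Finset.univ.filter (fun j => v j ≠ 0), z j ^ 2 +
          ∑ j, {x : ℝ | a - 2 * η ≤ |x|}.indicator 1 (z j)} := by
    intro z hz
    simp only [Set.mem_union, Set.mem_ofPred_eq]
    by_contra! hcon
    have h1 := sum_robustThresh_shift_ge (a := a) hη1 hcon.1 hv hcon.2
    have h2 : ∑ j, robustThresh a η (v j + z j - median (fun k => v k + z k)) ≤ r := hz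
    have hBs : 0 ≤ B * s := by positivity
    have h3 : (2 + max (nu a) (a ^ 2)) * (B * s) ≤ 138 * B * (s * logTerm p n s) := by
      calc (2 + max (nu a) (a ^ 2)) * (B * s) ≤ (138 * logTerm p n s) * (B * s) := by
            apply mul_le_mul_of_nonneg_right _ hBs; linarith
        _ = _ := by ring
    have h4 : (8 + max (nu a) (a ^ 2)) * s ≤ 144 * (s * logTerm p n s) := by
      calc (8 + max (nu a) (a ^ 2)) * s ≤ (144 * logTerm p n s) * s := by
            apply mul_le_mul_of_nonneg_right _ hs'.le; linarith
        _ = _ := by ring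
    have hsA : 1 ≤ s * logTerm p n s := one_le_mul_of_one_le_of_one_le hs1 hA
    have h5 : 138 * B * (s * logTerm p n s) ≤ 138 * B * sparseRate p n s :=
      mul_le_mul_of_nonneg_left hrate (by positivity)
    -- The signal gives `4CR`, the losses are at most `(138B + 144)R`, and `3C ≥ 3 · 128 + 138B`
    -- leaves more than `CR`; hence the `46 = 138/3`.
    have h6 := mul_le_mul_of_nonneg_right hC (by linarith : 0 ≤ sparseRate p n s)
    rw [add_mul] at h6
    linarith
  have h1 := gaussPi_median_tail hp hη0 hη1 (by linarith)
    (add_sqrt_le_radius hp hs h5) hv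
  have h2 := gaussPi_noise_tail (b := a - 2 * η) (by linarith) (by positivity : 0 < B * s) hv
  have h3 : (s + p * (4 * Real.exp (-(15 / 32) * (a - 2 * η) ^ 2))) / (B * s) ≤ ε / 4 := by
    have e1 : Real.exp (-(15 / 32) * (a - 2 * η) ^ 2) ≤
        Real.exp (-(3 / 2) * logTerm p n s) * Real.exp (15 / 2) := by
      rw [← Real.exp_add]
      apply Real.exp_le_exp.2
      -- The difference is `(a - 10η)²/5 + 16(1 - η²)`. Multiplied by `15/32`, the left side is
      -- `3A/2 - 15/2`, the source of `exp(15/2)`.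
      have : 4 / 5 * a ^ 2 - 16 ≤ (a - 2 * η) ^ 2 := by
        nlinarith [sq_nonneg (a - 10 * η), mul_le_mul hη1 hη1 hη0 zero_le_one]
      linarith
    have e2 := mul_le_mul_of_nonneg_right (mul_exp_logTerm_le hs hp hL h5)
      (Real.exp_pos (15 / 2)).le
    have e3 := mul_le_mul_of_nonneg_left e1 (Nat.cast_nonneg (α := ℝ) p)
    rw [div_le_iff₀ (by positivity)]
    have e4 : ε / 4 * (B * s) = (1 + 4 * Real.exp (15 / 2)) * s := by
      rw [hB]; field_simp
    rw [e4]
    linarith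
  have := (measureReal_mono (μ := gaussPi p) hsub (by finiteness)).trans
    (measureReal_union_le _ _)
  linarith

theorem law_null_le {p n s : ℕ} {γ r : ℝ} (hn : 2 ≤ n) (hp : 0 < p) (hs : 1 ≤ s)
    (h0 : 0 ≤ γ) (h1 : γ < 1) (h5 : (s : ℝ) ^ 5 ≤ p * loglog n)
    (hc : loglog n / (p : ℝ) ≤ 1 / 400) (hr : 128 * sparseRate p n s ≤ r) {θ : Data p n}
    (hθ : θ ∈ nullSpace p n) :
    law (equicorr p γ) θ {X | r < statistic γ (Real.sqrt (4 * logTerm p n s)) 20 X} ≤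
      ENNReal.ofReal (6 / Real.log (8 * (n : ℝ))) := by
  obtain ⟨μ, hμ⟩ := hθ
  have hlog := log_pos_of_two_le hn
  have hset : {X : Data p n | r < statistic γ (Real.sqrt (4 * logTerm p n s)) 20 X} =
      ⋃ t ∈ grid n, {X | (fun j => centredCusum γ X t j) ∈ {y : Fin p → ℝ |
        r < ∑ j, robustThresh (Real.sqrt (4 * logTerm p n s))
          (20 * Real.sqrt (loglog n / (p : ℝ))) (y j)}} := by
    ext X
    simp [statistic, Finset.lt_sup'_iff]
  have hone : ∀ t ∈ grid n, law (equicorr p γ) θ {X | (fun j => centredCusum γ X t j) ∈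
      {y : Fin p → ℝ | r < ∑ j, robustThresh (Real.sqrt (4 * logTerm p n s))
          (20 * Real.sqrt (loglog n / (p : ℝ))) (y j)}} ≤
      ENNReal.ofReal (3 * Real.exp (-2 * loglog n)) := by
    intro t ht
    obtain ⟨ht0, htn⟩ := pos_and_two_mul_le_of_mem_grid hn ht
    have hzero : cusum θ t = 0 := by
      rw [cusum_eq_of_two_levels (by omega) (fun i _ => hμ i) (fun i _ => hμ i), sub_self,
        smul_zero]
    rw [law_centredCusum_mem hp ht0 htn h0 h1 θ
      (measurableSet_sum_robustThresh p (by positivity) r), ← ofReal_measureReal]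
    apply ENNReal.ofReal_le_ofReal
    simpa [hzero] using gaussPi_null_tail hp hs (one_le_loglog hn) h5 hc hr
  rw [hset]
  refine (measure_biUnion_finset_le _ _).trans ((Finset.sum_le_sum hone).trans ?_)
  rw [Finset.sum_const, nsmul_eq_mul, ← ENNReal.ofReal_natCast,
    ← ENNReal.ofReal_mul (Nat.cast_nonneg _)]
  apply ENNReal.ofReal_le_ofReal
  have e : Real.exp (-2 * loglog n) = (Real.log (8 * (n : ℝ)) ^ 2)⁻¹ := by
    rw [← exp_loglog hn, ← Real.exp_nat_mul, ← Real.exp_neg]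
    congr 1
    push_cast
    ring
  rw [e]
  calc ((grid n).card : ℝ) * (3 * (Real.log (8 * (n : ℝ)) ^ 2)⁻¹)
      ≤ (2 * Real.log (8 * (n : ℝ))) * (3 * (Real.log (8 * (n : ℝ)) ^ 2)⁻¹) := by
        gcongr
        exact card_grid_le hn
    _ = 6 / Real.log (8 * (n : ℝ)) := by
        field_simp
        norm_num

theorem law_alternative_le {p n s : ℕ} {γ ρ r ε C : ℝ} (hn : 2 ≤ n) (hp : 0 < p) (hs : 1 ≤ s)
    (h0 : 0 ≤ γ) (h1 : γ < 1) (h5 : (s : ℝ) ^ 5 ≤ p * loglog n)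
    (hc : loglog n / (p : ℝ) ≤ 1 / 400) (hε : 0 < ε)
    (hC : 128 + 46 * (4 * (1 + 4 * Real.exp (15 / 2)) / ε) ≤ C)
    (hr : r = C * sparseRate p n s) (hρ : 32 * C * (1 - γ) * sparseRate p n s ≤ ρ ^ 2)
    {θ : Data p n} (hθ : θ ∈ altSpace p n s ρ) :
    law (equicorr p γ) θ {X | statistic γ (Real.sqrt (4 * logTerm p n s)) 20 X ≤ r} ≤
      ENNReal.ofReal (2 / Real.log (8 * (n : ℝ)) + ε / 4) := by
  simp only [altSpace, Set.mem_iUnion] at hθ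
  obtain ⟨t₀, ht₀, μ₁, μ₂, hμ₁, hμ₂, hcard, hnorm⟩ := hθ
  obtain ⟨t, ht, htt₀, ht₀t, hfac⟩ := exists_mem_grid ht₀
  obtain ⟨ht0, htn⟩ := pos_and_two_mul_le_of_mem_grid hn ht
  have hL := one_le_loglog hn
  have hlog := log_pos_of_two_le hn
  have hγ : 0 < 1 - γ := by linarith
  have hmean : cusum θ t = ((Real.sqrt (2 * (t : ℝ)))⁻¹ * t) • (μ₁ - μ₂) :=
    cusum_eq_of_two_levels (by omega) (fun i hi => hμ₁ i (by omega))
      (fun i hi => hμ₂ i (by omega))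
  have hsub : {X : Data p n | statistic γ (Real.sqrt (4 * logTerm p n s)) 20 X ≤ r} ⊆
      {X | (fun j => centredCusum γ X t j) ∈ {y : Fin p → ℝ |
        r < ∑ j, robustThresh (Real.sqrt (4 * logTerm p n s))
          (20 * Real.sqrt (loglog n / (p : ℝ))) (y j)}ᶜ} := by
    intro X hX
    have hX' : statistic γ (Real.sqrt (4 * logTerm p n s)) 20 X ≤ r := hX
    simp only [statistic, Finset.sup'_le_iff] at hX'
    simpa using hX' t ht
  have hv : (Finset.univ.filter fun j => cusum θ t j / Real.sqrt (1 - γ) ≠ 0).card ≤ s := by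
    refine (Finset.card_le_card fun j hj => ?_).trans hcard
    simp only [Finset.mem_filter, Finset.mem_univ, true_and] at hj ⊢
    intro h
    apply hj
    rw [hmean, PiLp.smul_apply, h, smul_zero, zero_div]
  -- `‖v‖² = t‖μ₁ - μ₂‖² / (2(1-γ)) ≥ ρ² / (4(1-γ))` by the choice of `t`; this is where `32 = 4 ·
  -- 8` enters.
  have hvr : 8 * C * sparseRate p n s ≤ ∑ j, (cusum θ t j / Real.sqrt (1 - γ)) ^ 2 := by
    have e1 : ∑ j, (cusum θ t j / Real.sqrt (1 - γ)) ^ 2 =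
        (t / 2 * ‖μ₁ - μ₂‖ ^ 2) / (1 - γ) := by
      simp only [div_pow, Real.sq_sqrt hγ.le]
      rw [← Finset.sum_div, ← EuclideanSpace.real_norm_sq_eq, hmean, norm_smul, mul_pow,
        Real.norm_eq_abs, sq_abs, sq_cusum_factor ht0]
    rw [e1, le_div_iff₀ hγ]
    have e2 := mul_le_mul_of_nonneg_right hfac (sq_nonneg ‖μ₁ - μ₂‖)
    linarith
  refine (measure_mono hsub).trans ?_
  rw [law_centredCusum_mem hp ht0 htn h0 h1 θ
    (measurableSet_sum_robustThresh p (by positivity) r).compl, ← ofReal_measureReal]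
  apply ENNReal.ofReal_le_ofReal
  have hmain := gaussPi_alternative_tail hp hs hL h5 hc hε hC hr hv hvr
  have e : Real.exp (-2 * loglog n) ≤ (Real.log (8 * (n : ℝ)))⁻¹ := by
    rw [← exp_loglog hn, ← Real.exp_neg]
    exact Real.exp_le_exp.2 (by linarith)
  have e' : 2 / Real.log (8 * (n : ℝ)) = 2 * (Real.log (8 * (n : ℝ)))⁻¹ := div_eq_mul_inv _ _
  simp only [Set.mem_compl_iff, Set.mem_ofPred_eq, not_lt]
  linarith

theorem lintegral_test {p n : ℕ} {γ a r C' : ℝ} (hC' : 0 ≤ C') (μ : Measure (Data p n)) :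
    ∫⁻ X, ENNReal.ofReal (test γ a r C' X) ∂μ = μ {X | r < statistic γ a C' X} := by
  have hm : MeasurableSet {X : Data p n | r < statistic γ a C' X} :=
    measurableSet_lt measurable_const (measurable_statistic γ hC')
  rw [← lintegral_indicator_one hm]
  refine lintegral_congr fun X => ?_
  by_cases h : r < statistic γ a C' X <;> simp [test, Set.indicator, h]

theorem lintegral_one_sub_test {p n : ℕ} {γ a r C' : ℝ} (hC' : 0 ≤ C') (μ : Measure (Data p n)) :
    ∫⁻ X, ENNReal.ofReal (1 - test γ a r C' X) ∂μ = μ {X | statistic γ a C' X ≤ r} := by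
  have hm : MeasurableSet {X : Data p n | statistic γ a C' X ≤ r} :=
    measurableSet_le (measurable_statistic γ hC') measurable_const
  rw [← lintegral_indicator_one hm]
  refine lintegral_congr fun X => ?_
  by_cases h : r < statistic γ a C' X
  · simp [test, Set.indicator, h, not_le.2 h]
  · simp [test, Set.indicator, h, not_lt.1 h]

end SparseChange

end

theorem mainTheorem8 :
    ∃ c C' : ℝ, 0 < c ∧ 0 < C' ∧
      ∀ ε : ℝ, 0 < ε → ε < 1 →
        ∃ (C : ℝ) (n₀ : ℕ), 0 < C ∧
          ∀ (p n s : ℕ) (γ ρ a r : ℝ),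
            2 ≤ n → n₀ ≤ n →
            1 ≤ s → s ≤ p →
            0 ≤ γ → γ < 1 →
            0 < ρ →
            (s : ℝ) ≤ ((p : ℝ) * SparseChange.loglog n) ^ ((1 : ℝ) / 5) →
            SparseChange.loglog n / (p : ℝ) ≤ c →
            a = Real.sqrt (4 * SparseChange.logTerm p n s) →
            r = C * SparseChange.sparseRate p n s →
            32 * C * (1 - γ) * SparseChange.sparseRate p n s ≤ ρ ^ 2 →
            Measurable (SparseChange.test (p := p) (n := n) γ a r C') ∧
              SparseChange.totalError (SparseChange.equicorr p γ)
                (SparseChange.nullSpace p n) (SparseChange.altSpace p n s ρ)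
                (SparseChange.test γ a r C') ≤ ENNReal.ofReal ε := by
  refine ⟨1 / 400, 20, by norm_num, by norm_num, fun ε hε _ =>
    -- The choice of `n₀` forces `log (8n) ≥ 12/ε`, so the two errors are at most `6 · ε/12 = ε/2`
    -- and `2 · ε/12 + ε/4 < ε/2`.
    ⟨128 + 46 * (4 * (1 + 4 * Real.exp (15 / 2)) / ε), ⌈Real.exp (12 / ε)⌉₊, by positivity, ?_⟩⟩
  intro p n s γ ρ a r hn hn₀ hs hsp h0 h1 _ hs5 hc ha hr hρ
  have hp : 0 < p := by omega
  have hL := SparseChange.one_le_loglog hn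
  have h5 := SparseChange.pow_five_le (by positivity) hs5
  have hlog := SparseChange.log_pos_of_two_le hn
  have hrate : 0 ≤ SparseChange.sparseRate p n s := by
    have : SparseChange.loglog n ≤ SparseChange.sparseRate p n s := le_max_right _ _
    linarith
  refine ⟨SparseChange.measurable_test γ r (by norm_num), ?_⟩
  have hlarge : 12 / ε ≤ Real.log (8 * (n : ℝ)) := by
    have hnpos : (0 : ℝ) < n := by exact_mod_cast (by omega : 0 < n)
    rw [Real.le_log_iff_exp_le (by positivity)]
    have h2 : Real.exp (12 / ε) ≤ n := (Nat.le_ceil _).trans (by exact_mod_cast hn₀)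
    linarith
  have hinv : (Real.log (8 * (n : ℝ)))⁻¹ ≤ ε / 12 := by
    rw [inv_le_comm₀ hlog (by positivity), inv_div]
    exact hlarge
  have e : ENNReal.ofReal ε = ENNReal.ofReal (ε / 2) + ENNReal.ofReal (ε / 2) := by
    rw [← ENNReal.ofReal_add (by positivity) (by positivity), add_halves]
  rw [e, SparseChange.totalError]
  refine add_le_add (iSup₂_le fun θ hθ => ?_) (iSup₂_le fun θ hθ => ?_)
  · rw [SparseChange.lintegral_test (by norm_num), ha]
    refine (SparseChange.law_null_le hn hp hs h0 h1 h5 hc ?_ hθ).trans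
      (ENNReal.ofReal_le_ofReal ?_)
    · rw [hr]
      apply mul_le_mul_of_nonneg_right _ hrate
      have : 0 ≤ 46 * (4 * (1 + 4 * Real.exp (15 / 2)) / ε) := by positivity
      linarith
    · rw [div_eq_mul_inv]
      linarith
  · rw [SparseChange.lintegral_one_sub_test (by norm_num), ha]
    refine (SparseChange.law_alternative_le hn hp hs h0 h1 h5 hc hε le_rfl hr hρ hθ).trans
      (ENNReal.ofReal_le_ofReal ?_)
    rw [div_eq_mul_inv]
    linarith
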